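/- Let $\mathbb K$ be $\mathbb R$ or $\mathbb C$ and $d\in\mathbb N$; all functions are $\mathbb K$-valued. Let $\mathcal O_M(\mathbb R^d)$ be the algebra of all $f\in C^\infty(\mathbb R^d)$ all of whose derivatives are polynomially bounded. For $\varphi\in\mathcal S(\mathbb R^d)$, $l\in\mathbb N$ and $f\in\mathcal O_M(\mathbb R^d)$ put $$\nu_{\varphi,l}(f)=\sup_{x\in\mathbb R^d,\ |\alpha|\le l}|\varphi(x)\,\partial^\alpha f(x)|<\infty .$$ Let $\mathcal M_{\mathcal O_M}(\mathbb R^d)$ be the algebra of all families $(f_\varepsilon)_{\varepsilon\in(0,1]}$ in $\mathcal O_M(\mathbb R^d)$ such that for all $\varphi\in\mathcal S(\mathbb R^d)$ and $l\in\mathbb N$ there is $m\in\mathbb N$ with $\nu_{\varphi,l}(f_\varepsilon)=o(\varepsilon^{-m})$ as $\varepsilon\to0$, and let $\mathcal N_{\mathcal O_M}(\mathbb R^d)$ be its ideal of all families such that $\nu_{\varphi,l}(f_\varepsilon)=o(\varepsilon^{m})$ as $\varepsilon\to 0$ for all $\varphi\in\mathcal S(\mathbb R^d)$, $l\in\mathbb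 N$, $m\in\mathbb N$. Let $\mathcal G_\tau(\mathbb R^d)=\mathcal M_{\mathcal O_M}(\mathbb R^d)/\mathcal N_{\mathcal O_M}(\mathbb R^d)$, with the derivatives $\partial^\alpha$ ($\alpha\in\mathbb N^d$) defined componentwise on representatives. **Proposition.** Let $\rho\in\mathcal S(\mathbb R^d)$ satisfy $\int\rho(x)\,dx=1$ and $\int x^\alpha\rho(x)\,dx=0$ for all $\alpha\in\mathbb N^d\setminus\{0\}$. Set $\rho_\varepsilon(x)=\varepsilon^{-d}\rho(x/\varepsilon)$ for $\varepsilon\in(0,1]$. (i) The map $\sigma_\tau:\mathcal O_M(\mathbb R^d)\to\mathcal G_\tau(\mathbb R^d)$, $u\mapsto (u)_\varepsilon+\mathcal N_{\mathcal O_M}(\mathbb R^d)$, is an embedding of differential algebras, i.e. an injective homomorphism of $\mathbb K$-algebras that commutes with all $\partial^\alpha$. (ii) For $T\in\mathcal S'(\mathbb R^d)$ the functions $T*\rho_\varepsilon$, $(T*\rho_\varepsilon)(x)=\langle T,\rho_\varepsilon(x-\cdot)\rangle$, belong to $\mathcal O_M(\mathbb R^d)$ and $(T*\rho_\varepsilon)_\varepsilon\in\mathcal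 M_{\mathcal O_M}(\mathbb R^d)$; and the map $\iota_\tau:\mathcal S'(\mathbb R^d)\to\mathcal G_\tau(\mathbb R^d)$, $T\mapsto(T*\rho_\varepsilon)_\varepsilon+\mathcal N_{\mathcal O_M}(\mathbb R^d)$, is an embedding of differential vector spaces, i.e. an injective $\mathbb K$-linear map that commutes with all $\partial^\alpha$. (iii) $\iota_\tau|_{\mathcal O_M(\mathbb R^d)}=\sigma_\tau$: for every $u\in\mathcal O_M(\mathbb R^d)$, with associated distribution $T_u:\varphi\mapsto\int\varphi(x)u(x)\,dx$, one has $\iota_\tau(T_u)=\sigma_\tau(u)$. -/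

import Mathlib

open Filter Topology MeasureTheory Asymptotics
open scoped SchwartzMap ContDiff LineDeriv

noncomputable section

namespace TemperedGF

/-- The Euclidean space `ℝ^d`. -/
abbrev Euc (d : ℕ) : Type := EuclideanSpace ℝ (Fin d)

/-- The `i`-th vector of the standard basis of `ℝ^d`. -/
abbrev stdVec {d : ℕ} (i : Fin d) : Euc d := EuclideanSpace.single i (1 : ℝ)

/-! ### Multi-index derivatives -/

/-- `D^α = D_1^{α_1} ∘ ⋯ ∘ D_d^{α_d}` for a family of linear operators `D_1, …, D_d`. -/
def multiDeriv {𝕜 X : Type*} [Semiring 𝕜] [AddCommMonoid X] [Module 𝕜 X] :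
    {d : ℕ} → (Fin d → Module.End 𝕜 X) → (Fin d → ℕ) → Module.End 𝕜 X :=
  fun D α => (List.ofFn fun i => D i ^ α i).prod

theorem multiDeriv_zero {𝕜 X : Type*} [Semiring 𝕜] [AddCommMonoid X] [Module 𝕜 X] {d : ℕ}
    (D : Fin d → Module.End 𝕜 X) : multiDeriv D 0 = 1 := by
  simp [multiDeriv]

theorem multiDeriv_add_single {𝕜 X : Type*} [Semiring 𝕜] [AddCommMonoid X] [Module 𝕜 X] {d : ℕ}
    (D : Fin d → Module.End 𝕜 X) (hD : ∀ i j, Commute (D i) (D j)) (α : Fin d → ℕ) (i : Fin d) :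
    multiDeriv D (α + Pi.single i 1) = multiDeriv D α * D i := by
  induction d with
  | zero => exact i.elim0
  | succ d ih =>
    have key : ∀ (β : Fin (d + 1) → ℕ), multiDeriv D β =
        D 0 ^ β 0 * multiDeriv (fun j : Fin d => D j.succ) (fun j => β j.succ) := by
      intro β
      simp [multiDeriv, List.ofFn_succ]
    rw [key, key]
    refine Fin.cases ?_ (fun j => ?_) i
    · have h1 : (fun j : Fin d => (α + Pi.single (0 : Fin (d + 1)) 1 : Fin (d + 1) → ℕ) j.succ) =
          fun j => α j.succ := by
        funext j; simp
      rw [h1]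
      have hc : Commute (D 0) (multiDeriv (fun j : Fin d => D j.succ) (fun j => α j.succ)) := by
        unfold multiDeriv
        apply Commute.list_prod_right
        intro y hy
        obtain ⟨j, rfl⟩ := (List.mem_ofFn' _ _).1 hy
        exact (hD 0 j.succ).pow_right _
      simp only [Pi.add_apply, Pi.single_eq_same, pow_succ]
      rw [mul_assoc, hc.eq, mul_assoc]
    · have h1 : (fun k : Fin d => (α + Pi.single j.succ 1 : Fin (d + 1) → ℕ) k.succ) =
          (fun k => α k.succ) + Pi.single j 1 := by
        funext k
        by_cases h : k = j
        · subst h; simp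
        · simp [h]
      have h2 : (α + Pi.single j.succ 1 : Fin (d + 1) → ℕ) 0 = α 0 := by
        simp
      rw [h1, h2, ih _ (fun a b => hD _ _), mul_assoc]

/-! ### The space `O_M` of multipliers -/

/-- The algebra `O_M(ℝ^d)` of smooth functions all of whose derivatives are polynomially
bounded. -/
def OM (𝕜 : Type*) [RCLike 𝕜] (d : ℕ) : Subalgebra 𝕜 (Euc d → 𝕜) where
  carrier := {f | Function.HasTemperateGrowth f}
  mul_mem' hf hg := hf.mul hg
  add_mem' hf hg := hf.add hg
  algebraMap_mem' c := Function.HasTemperateGrowth.const c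

variable {𝕜 : Type*} [RCLike 𝕜] {d : ℕ}

instance : CommRing (OM 𝕜 d) := Subalgebra.toCommRing (R := 𝕜) (A := Euc d → 𝕜) _

instance : Algebra 𝕜 (OM 𝕜 d) := Subalgebra.algebra _

theorem OM.contDiff (f : OM 𝕜 d) : ContDiff ℝ ∞ (f : Euc d → 𝕜) := f.2.1

theorem OM.differentiable (f : OM 𝕜 d) : Differentiable ℝ (f : Euc d → 𝕜) :=
  f.2.1.differentiable (by simp)

theorem OM.fderiv_mem (f : OM 𝕜 d) (v : Euc d) :
    (fun x => fderiv ℝ (f : Euc d → 𝕜) x v) ∈ OM 𝕜 d := by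
  have h1 : ContDiff ℝ ∞ (fderiv ℝ (f : Euc d → 𝕜)) := f.2.1.fderiv_right (by simp)
  refine ⟨h1.clm_apply contDiff_const, fun n => ?_⟩
  obtain ⟨k, C, h⟩ := f.2.2 (n + 1)
  refine ⟨k, ‖v‖ * C, fun x => ?_⟩
  refine (norm_iteratedFDeriv_clm_apply_const (N := ∞) h1.contDiffAt (mod_cast le_top)).trans ?_
  rw [norm_iteratedFDeriv_fderiv, mul_assoc]
  gcongr
  exact h x

variable (𝕜) in
/-- The partial derivative `∂_i` on `O_M(ℝ^d)`, as a derivation. -/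
def OM.pd (i : Fin d) : Derivation 𝕜 (OM 𝕜 d) (OM 𝕜 d) :=
  Derivation.mk'
    { toFun := fun f => ⟨fun x => fderiv ℝ (f : Euc d → 𝕜) x (stdVec i), OM.fderiv_mem f _⟩
      map_add' := fun f g => by
        ext x
        simp [fderiv_add (OM.differentiable f x) (OM.differentiable g x)]
      map_smul' := fun c f => by
        ext x
        simp [fderiv_const_smul (OM.differentiable f x) c] }
    (fun f g => by
      ext x
      simp [fderiv_mul (OM.differentiable f x) (OM.differentiable g x)])

theorem OM.pd_apply (i : Fin d) (f : OM 𝕜 d) (x : Euc d) :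
    (OM.pd 𝕜 i f : Euc d → 𝕜) x = fderiv ℝ (f : Euc d → 𝕜) x (stdVec i) := rfl

/-- The multi-index derivative `∂^α` on `O_M(ℝ^d)`. -/
def OM.deriv (α : Fin d → ℕ) : Module.End 𝕜 (OM 𝕜 d) :=
  multiDeriv (fun i => (OM.pd 𝕜 i : OM 𝕜 d →ₗ[𝕜] OM 𝕜 d)) α

theorem OM.pd_comm (i j : Fin d) :
    Commute (OM.pd 𝕜 i : Module.End 𝕜 (OM 𝕜 d)) (OM.pd 𝕜 j : OM 𝕜 d →ₗ[𝕜] OM 𝕜 d) := by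
  refine LinearMap.ext fun f => ?_
  ext x
  have h1 : Differentiable ℝ (fderiv ℝ (f : Euc d → 𝕜)) :=
    (f.2.1.fderiv_right (m := ∞) (by simp)).differentiable (by simp)
  have hs : IsSymmSndFDerivAt ℝ (f : Euc d → 𝕜) x :=
    (f.2.1.contDiffAt (x := x)).isSymmSndFDerivAt (by simpa using (WithTop.coe_le_coe.2 le_top : ((2 : ℕ∞) : WithTop ℕ∞) ≤ ∞))
  have key : ∀ a b : Fin d, (OM.pd 𝕜 a (OM.pd 𝕜 b f) : Euc d → 𝕜) x =
      fderiv ℝ (fderiv ℝ (f : Euc d → 𝕜)) x (stdVec a) (stdVec b) := by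
    intro a b
    rw [OM.pd_apply]
    change fderiv ℝ (fun y => fderiv ℝ (f : Euc d → 𝕜) y (stdVec b)) x (stdVec a) = _
    rw [fderiv_clm_apply (h1 x) (by fun_prop)]
    simp
  change (OM.pd 𝕜 i (OM.pd 𝕜 j f) : Euc d → 𝕜) x =
    (OM.pd 𝕜 j (OM.pd 𝕜 i f) : Euc d → 𝕜) x
  rw [key, key]
  exact hs _ _

theorem OM.deriv_zero (f : OM 𝕜 d) : OM.deriv 0 f = f := by
  simp [OM.deriv, multiDeriv_zero]

theorem OM.deriv_add_single (α : Fin d → ℕ) (i : Fin d) (f : OM 𝕜 d) :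
    OM.deriv (α + Pi.single i 1) f = OM.deriv α (OM.pd 𝕜 i f) := by
  unfold OM.deriv
  rw [multiDeriv_add_single _ OM.pd_comm]
  rfl

/-- The multi-indices of length at most `l`. -/
abbrev MIdx (d l : ℕ) : Type := {α : Fin d → ℕ // ∑ i, α i ≤ l}

instance (d l : ℕ) : Finite (MIdx d l) := by
  refine Set.Finite.to_subtype (Set.Finite.subset
    (Set.finite_Iic (fun _ : Fin d => l)) fun α hα i => ?_)
  exact (Finset.single_le_sum (f := α) (fun _ _ => Nat.zero_le _) (Finset.mem_univ i)).trans hα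

/-- The semi-norm `ν_{φ,l}(f) = sup_{x ∈ ℝ^d, |α| ≤ l} |φ(x) ∂^α f(x)|` on `O_M(ℝ^d)`, for
`φ ∈ S(ℝ^d)`. The supremum is finite: see `bddAbove_nu`. -/
def nu (φ : 𝓢(Euc d, 𝕜)) (l : ℕ) (f : OM 𝕜 d) : ℝ :=
  ⨆ p : Euc d × MIdx d l, ‖φ p.1 * (OM.deriv p.2.1 f : Euc d → 𝕜) p.1‖

theorem bddAbove_nu (φ : 𝓢(Euc d, 𝕜)) (l : ℕ) (f : OM 𝕜 d) :
    BddAbove (Set.range fun p : Euc d × MIdx d l =>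
      ‖φ p.1 * (OM.deriv p.2.1 f : Euc d → 𝕜) p.1‖) := by
  have h : ∀ α : MIdx d l, ∃ C : ℝ, ∀ x, ‖φ x * (OM.deriv α.1 f : Euc d → 𝕜) x‖ ≤ C := by
    intro α
    have ht : Function.HasTemperateGrowth (OM.deriv α.1 f : Euc d → 𝕜) := (OM.deriv α.1 f).2
    refine ⟨SchwartzMap.seminorm 𝕜 0 0
      (SchwartzMap.smulLeftCLM 𝕜 (OM.deriv α.1 f : Euc d → 𝕜) φ), fun x => ?_⟩
    have := SchwartzMap.norm_le_seminorm 𝕜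
      (SchwartzMap.smulLeftCLM 𝕜 (OM.deriv α.1 f : Euc d → 𝕜) φ) x
    rwa [SchwartzMap.smulLeftCLM_apply_apply ht, smul_eq_mul, mul_comm] at this
  choose C hC using h
  obtain ⟨B, hB⟩ := (Set.finite_range C).bddAbove
  refine ⟨B, ?_⟩
  rintro _ ⟨⟨x, α⟩, rfl⟩
  exact (hC α x).trans (hB ⟨α, rfl⟩)

theorem le_nu (φ : 𝓢(Euc d, 𝕜)) (l : ℕ) (f : OM 𝕜 d) (x : Euc d) (α : Fin d → ℕ)
    (hα : ∑ i, α i ≤ l) : ‖φ x * (OM.deriv α f : Euc d → 𝕜) x‖ ≤ nu φ l f :=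
  le_ciSup (bddAbove_nu φ l f) (x, ⟨α, hα⟩)

theorem nu_nonneg (φ : 𝓢(Euc d, 𝕜)) (l : ℕ) (f : OM 𝕜 d) : 0 ≤ nu φ l f :=
  Real.iSup_nonneg fun _ => norm_nonneg _

theorem nu_le (φ : 𝓢(Euc d, 𝕜)) (l : ℕ) (f : OM 𝕜 d) (C : ℝ)
    (h : ∀ x (α : Fin d → ℕ), ∑ i, α i ≤ l → ‖φ x * (OM.deriv α f : Euc d → 𝕜) x‖ ≤ C) :
    nu φ l f ≤ C := by
  have : Nonempty (Euc d × MIdx d l) := ⟨(0, ⟨0, by simp⟩)⟩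
  exact ciSup_le fun p => h p.1 p.2.1 p.2.2

theorem nu_add_le (φ : 𝓢(Euc d, 𝕜)) (l : ℕ) (f g : OM 𝕜 d) :
    nu φ l (f + g) ≤ nu φ l f + nu φ l g := by
  refine nu_le _ _ _ _ fun x α hα => ?_
  have : (OM.deriv α (f + g) : Euc d → 𝕜) x =
      (OM.deriv α f : Euc d → 𝕜) x + (OM.deriv α g : Euc d → 𝕜) x := by
    rw [map_add]; rfl
  rw [this, mul_add]
  exact (norm_add_le _ _).trans (add_le_add (le_nu _ _ _ _ _ hα) (le_nu _ _ _ _ _ hα))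

theorem nu_pd_le (φ : 𝓢(Euc d, 𝕜)) (l : ℕ) (i : Fin d) (f : OM 𝕜 d) :
    nu φ l (OM.pd 𝕜 i f) ≤ nu φ (l + 1) f := by
  refine nu_le _ _ _ _ fun x α hα => ?_
  rw [← OM.deriv_add_single]
  refine le_nu _ _ _ _ _ ?_
  simpa [Finset.sum_add_distrib] using hα

theorem OM.norm_deriv_mul_le (n : ℕ) : ∀ (α : Fin d → ℕ), ∑ i, α i = n →
    ∀ (f g : OM 𝕜 d) (x : Euc d) (B C : ℝ),
    (∀ β : Fin d → ℕ, ∑ i, β i ≤ n → ‖(OM.deriv β f : Euc d → 𝕜) x‖ ≤ B) →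
    (∀ β : Fin d → ℕ, ∑ i, β i ≤ n → ‖(OM.deriv β g : Euc d → 𝕜) x‖ ≤ C) →
    ‖(OM.deriv α (f * g) : Euc d → 𝕜) x‖ ≤ 2 ^ n * (B * C) := by
  induction n with
  | zero =>
    intro α hα f g x B C hf hg
    have h0 : α = 0 := by
      funext i
      exact (Finset.sum_eq_zero_iff.1 hα) i (Finset.mem_univ i)
    subst h0
    have h1 := hf 0 (by simp)
    have h2 := hg 0 (by simp)
    rw [OM.deriv_zero] at h1 h2 ⊢
    simp only [MulMemClass.coe_mul, Pi.mul_apply, norm_mul, pow_zero, one_mul]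
    exact mul_le_mul h1 h2 (norm_nonneg _) ((norm_nonneg _).trans h1)
  | succ n ih =>
    intro α hα f g x B C hf hg
    obtain ⟨i, hi⟩ : ∃ i, α i ≠ 0 := by
      by_contra! h
      simp [h] at hα
    obtain ⟨β, rfl⟩ : ∃ β : Fin d → ℕ, α = β + Pi.single i 1 := by
      refine ⟨fun j => if j = i then α j - 1 else α j, ?_⟩
      funext j
      by_cases h : j = i
      · subst h; simp; omega
      · simp [h]
    have hβ : ∑ j, β j = n := by simpa [Finset.sum_add_distrib] using hα
    have hd : ∀ (u : OM 𝕜 d) (A : ℝ),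
        (∀ γ : Fin d → ℕ, ∑ i, γ i ≤ n + 1 → ‖(OM.deriv γ u : Euc d → 𝕜) x‖ ≤ A) →
        ∀ γ : Fin d → ℕ, ∑ i, γ i ≤ n → ‖(OM.deriv γ (OM.pd 𝕜 i u) : Euc d → 𝕜) x‖ ≤ A := by
      intro u A hu γ hγ
      rw [← OM.deriv_add_single]
      exact hu _ (by simpa [Finset.sum_add_distrib] using hγ)
    have e1 := ih β hβ f (OM.pd 𝕜 i g) x B C (fun γ hγ => hf γ (by omega)) (hd g C hg)
    have e2 := ih β hβ g (OM.pd 𝕜 i f) x C B (fun γ hγ => hg γ (by omega)) (hd f B hf)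
    have hL : (OM.deriv (β + Pi.single i 1) (f * g) : Euc d → 𝕜) x =
        (OM.deriv β (f * OM.pd 𝕜 i g) : Euc d → 𝕜) x +
        (OM.deriv β (g * OM.pd 𝕜 i f) : Euc d → 𝕜) x := by
      rw [OM.deriv_add_single, Derivation.leibniz, map_add]; rfl
    rw [hL]
    refine (norm_add_le _ _).trans ((add_le_add e1 e2).trans (le_of_eq ?_))
    ring

/-! ### Continuity of the product -/

theorem exists_majorant_real (h : Euc d → ℝ) (h0 : ∀ x, 0 ≤ h x)
    (hdec : ∀ k : ℕ, ∃ C, ∀ x, (1 + ‖x‖) ^ k * h x ≤ C) :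
    ∃ ψ : 𝓢(Euc d, ℝ), ∀ x, h x ≤ ψ x := by
  let χ : ContDiffBump (0 : Euc d) := ⟨1, 2, by norm_num, by norm_num⟩
  have hχs : ContDiff ℝ ∞ (χ : Euc d → ℝ) := χ.contDiff
  have hχb : ∀ l : ℕ, ∃ C, 0 ≤ C ∧ ∀ x, ‖iteratedFDeriv ℝ l (χ : Euc d → ℝ) x‖ ≤ C := by
    intro l
    obtain ⟨C, hC⟩ := (χ.hasCompactSupport.iteratedFDeriv (𝕜 := ℝ) l).exists_bound_of_continuous
      (hχs.continuous_iteratedFDeriv (mod_cast le_top))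
    exact ⟨C, (norm_nonneg _).trans (hC 0), hC⟩
  choose B hB0 hB using hχb
  choose C hC using hdec
  let c : ℕ → ℝ := fun n => ⨆ x : {x : Euc d // (n : ℝ) ≤ ‖x‖}, h x
  have hbdd : ∀ n : ℕ, BddAbove (Set.range fun x : {x : Euc d // (n : ℝ) ≤ ‖x‖} => h x) := by
    intro n
    refine ⟨C 0, ?_⟩
    rintro _ ⟨x, rfl⟩
    simpa using hC 0 x
  have hc0 : ∀ n, 0 ≤ c n := fun n => Real.iSup_nonneg fun _ => h0 _
  have hC0 : ∀ k, 0 ≤ C k := fun k =>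
    (mul_nonneg (by positivity) (h0 0)).trans (hC k 0)
  have hcdec : ∀ k n : ℕ, ((n : ℝ) + 1) ^ k * c n ≤ C k := by
    intro k n
    rw [← le_div_iff₀' (by positivity)]
    refine Real.iSup_le (fun x => ?_) (div_nonneg (hC0 k) (by positivity))
    rw [le_div_iff₀' (by positivity)]
    refine le_trans ?_ (hC k x)
    have := x.2
    have := h0 x
    gcongr ?_ ^ k * _
    linarith
  let g : ℕ → Euc d → ℝ := fun n x => c n * χ (((n : ℝ) + 1)⁻¹ • x)
  have hgs : ∀ n, ContDiff ℝ ∞ (g n) := fun n =>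
    contDiff_const.mul (hχs.comp (contDiff_id.const_smul (((n : ℝ) + 1)⁻¹)))
  have hgd : ∀ n l x, ‖iteratedFDeriv ℝ l (g n) x‖ ≤
      c n * ‖iteratedFDeriv ℝ l (χ : Euc d → ℝ) (((n : ℝ) + 1)⁻¹ • x)‖ := by
    intro n l x
    have e1 : iteratedFDeriv ℝ l (g n) x =
        c n • iteratedFDeriv ℝ l (fun z => χ (((n : ℝ) + 1)⁻¹ • z)) x := by
      refine iteratedFDeriv_const_smul_apply' (a := c n) (f := fun z => χ (((n : ℝ) + 1)⁻¹ • z)) ?_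
      exact ((hχs.comp (contDiff_id.const_smul (((n : ℝ) + 1)⁻¹))).of_le (mod_cast le_top)).contDiffAt
    rw [e1, iteratedFDeriv_comp_const_smul _ (hχs.of_le (mod_cast le_top)), norm_smul, norm_smul,
      Real.norm_of_nonneg (hc0 n)]
    refine mul_le_mul_of_nonneg_left ?_ (hc0 n)
    refine mul_le_of_le_one_left (norm_nonneg _) ?_
    rw [norm_pow, norm_inv]
    refine pow_le_one₀ (by positivity) (inv_le_one_of_one_le₀ ?_)
    rw [Real.norm_of_nonneg (by positivity)]
    linarith [(Nat.cast_nonneg n : (0 : ℝ) ≤ n)]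
  have hgk : ∀ k l n x, ‖x‖ ^ k * ‖iteratedFDeriv ℝ l (g n) x‖ ≤
      2 ^ k * B l * C (k + 2) * (((n : ℝ) + 1) ^ 2)⁻¹ := by
    intro k l n x
    have hpos : (0 : ℝ) < (n : ℝ) + 1 := by positivity
    by_cases hx : ‖x‖ ≤ 2 * ((n : ℝ) + 1)
    · have := hcdec (k + 2) n
      have h1 : ((n : ℝ) + 1) ^ k * c n ≤ C (k + 2) * (((n : ℝ) + 1) ^ 2)⁻¹ := by
        rw [← div_eq_mul_inv, le_div_iff₀ (by positivity)]
        calc _ = ((n : ℝ) + 1) ^ (k + 2) * c n := by ring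
          _ ≤ _ := this
      calc ‖x‖ ^ k * ‖iteratedFDeriv ℝ l (g n) x‖
          ≤ (2 * ((n : ℝ) + 1)) ^ k * (c n * B l) := by
            have := hc0 n
            refine mul_le_mul (by gcongr) ((hgd n l x).trans ?_) (norm_nonneg _) (by positivity)
            gcongr
            exact hB l _
        _ = 2 ^ k * B l * (((n : ℝ) + 1) ^ k * c n) := by rw [mul_pow]; ring
        _ ≤ 2 ^ k * B l * (C (k + 2) * (((n : ℝ) + 1) ^ 2)⁻¹) := by
            have := hB0 l
            gcongr
        _ = _ := by ring
    · have hz : iteratedFDeriv ℝ l (χ : Euc d → ℝ) (((n : ℝ) + 1)⁻¹ • x) = 0 := by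
        refine image_eq_zero_of_notMem_tsupport fun hmem => hx ?_
        have h2 := tsupport_iteratedFDeriv_subset (𝕜 := ℝ) l hmem
        rw [χ.tsupport_eq, mem_closedBall_zero_iff, norm_smul, norm_inv,
          Real.norm_of_nonneg hpos.le, inv_mul_le_iff₀ hpos] at h2
        change ‖x‖ ≤ ((n : ℝ) + 1) * 2 at h2
        linarith
      have h3 := hgd n l x
      rw [hz, norm_zero, mul_zero] at h3
      have h4 : ‖iteratedFDeriv ℝ l (g n) x‖ = 0 := le_antisymm h3 (norm_nonneg _)
      rw [h4, mul_zero]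
      have := hB0 l
      have := hC0 (k + 2)
      positivity
  have hsum : Summable fun n : ℕ => (((n : ℝ) + 1) ^ 2)⁻¹ := by
    have := (summable_nat_add_iff 1).2 (Real.summable_nat_pow_inv.2 (le_refl 2))
    simpa using this
  let v : ℕ → ℕ → ℝ := fun l n => B l * C 2 * (((n : ℝ) + 1) ^ 2)⁻¹
  have hv : ∀ l : ℕ, (l : ℕ∞) ≤ (⊤ : ℕ∞) → Summable (v l) := fun l _ => hsum.mul_left _
  have hgv : ∀ (l n : ℕ) (x : Euc d), (l : ℕ∞) ≤ (⊤ : ℕ∞) →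
      ‖iteratedFDeriv ℝ l (g n) x‖ ≤ v l n := by
    intro l n x _
    simpa [v] using hgk 0 l n x
  have hsm : ContDiff ℝ ∞ fun x => ∑' n, g n x := contDiff_tsum hgs hv hgv
  refine ⟨⟨fun x => ∑' n, g n x, hsm, fun k l => ?_⟩, fun x => ?_⟩
  · refine ⟨∑' n : ℕ, 2 ^ k * B l * C (k + 2) * (((n : ℝ) + 1) ^ 2)⁻¹, fun x => ?_⟩
    rw [iteratedFDeriv_tsum_apply hgs hv hgv le_top x]
    have hs1 : Summable fun n => ‖iteratedFDeriv ℝ l (g n) x‖ :=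
      Summable.of_nonneg_of_le (fun _ => norm_nonneg _) (fun n => hgv l n x le_top) (hv l le_top)
    calc _ ≤ ‖x‖ ^ k * ∑' n, ‖iteratedFDeriv ℝ l (g n) x‖ := by
          gcongr
          exact norm_tsum_le_tsum_norm hs1
      _ = ∑' n, ‖x‖ ^ k * ‖iteratedFDeriv ℝ l (g n) x‖ := tsum_mul_left.symm
      _ ≤ _ := Summable.tsum_le_tsum (fun n => hgk k l n x) (hs1.mul_left _) (hsum.mul_left _)
  · change h x ≤ ∑' n, g n x
    have hs0 : Summable fun n => g n x := by
      refine Summable.of_norm_bounded (hv 0 le_top) fun n => ?_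
      simpa using hgv 0 n x le_top
    have hg0 : ∀ n, 0 ≤ g n x := fun n => mul_nonneg (hc0 n) χ.nonneg
    refine le_trans ?_ (hs0.le_tsum ⌊‖x‖⌋₊ fun n _ => hg0 n)
    have hone : χ (((⌊‖x‖⌋₊ : ℝ) + 1)⁻¹ • x) = 1 := by
      refine χ.one_of_mem_closedBall ?_
      rw [mem_closedBall_zero_iff, norm_smul, norm_inv, Real.norm_of_nonneg (by positivity),
        inv_mul_le_iff₀ (by positivity)]
      change ‖x‖ ≤ _ * 1
      rw [mul_one]
      exact (Nat.lt_floor_add_one _).le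
    change h x ≤ c _ * _
    rw [hone, mul_one]
    exact le_ciSup (hbdd _) (⟨x, Nat.floor_le (norm_nonneg _)⟩ : {y : Euc d // _ ≤ ‖y‖})

theorem exists_sq_majorant (φ : 𝓢(Euc d, 𝕜)) :
    ∃ ψ : 𝓢(Euc d, 𝕜), ∀ x, ‖φ x‖ ≤ ‖ψ x‖ ^ 2 := by
  obtain ⟨ψ, hψ⟩ := exists_majorant_real (fun x : Euc d => Real.sqrt ‖φ x‖)
    (fun x => Real.sqrt_nonneg _) (fun k => by
      refine ⟨Real.sqrt (2 ^ (2 * k) * (Finset.Iic (2 * k, 0)).sup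
        (fun m => SchwartzMap.seminorm 𝕜 m.1 m.2) φ), fun x => ?_⟩
      refine Real.le_sqrt_of_sq_le ?_
      have := SchwartzMap.one_add_le_sup_seminorm_apply (𝕜 := 𝕜) (m := (2 * k, 0)) (k := 2 * k)
        (n := 0) le_rfl le_rfl φ x
      rw [norm_iteratedFDeriv_zero] at this
      rw [mul_pow, Real.sq_sqrt (norm_nonneg _), ← pow_mul, mul_comm k 2]
      exact this)
  refine ⟨ψ.postcompCLM (𝕜 := ℝ) (RCLike.ofRealCLM : ℝ →L[ℝ] 𝕜), fun x => ?_⟩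
  have h1 := hψ x
  have h2 : ‖ψ.postcompCLM (𝕜 := ℝ) (RCLike.ofRealCLM : ℝ →L[ℝ] 𝕜) x‖ = |ψ x| := by
    simp
  rw [h2, sq_abs, ← Real.sq_sqrt (norm_nonneg (φ x))]
  gcongr

theorem exists_nu_mul_le (φ : 𝓢(Euc d, 𝕜)) (l : ℕ) :
    ∃ ψ : 𝓢(Euc d, 𝕜), ∀ f g : OM 𝕜 d, nu φ l (f * g) ≤ 2 ^ l * (nu ψ l f * nu ψ l g) := by
  obtain ⟨ψ, hψ⟩ := exists_sq_majorant φ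
  refine ⟨ψ, fun f g => nu_le _ _ _ _ fun x α hα => ?_⟩
  have hf0 := nu_nonneg ψ l f
  have hg0 := nu_nonneg ψ l g
  rcases eq_or_ne (ψ x) 0 with h0 | h0
  · have : φ x = 0 := by simpa [h0] using hψ x
    rw [this, zero_mul, norm_zero]
    positivity
  · have hpos : 0 < ‖ψ x‖ := norm_pos_iff.2 h0
    have hb : ∀ u : OM 𝕜 d, ∀ β : Fin d → ℕ, ∑ i, β i ≤ ∑ i, α i →
        ‖(OM.deriv β u : Euc d → 𝕜) x‖ ≤ nu ψ l u / ‖ψ x‖ := by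
      intro u β hβ
      rw [le_div_iff₀' hpos, ← norm_mul]
      exact le_nu _ _ _ _ _ (hβ.trans hα)
    have := OM.norm_deriv_mul_le _ α rfl f g x _ _ (hb f) (hb g)
    calc ‖φ x * (OM.deriv α (f * g) : Euc d → 𝕜) x‖
        ≤ ‖ψ x‖ ^ 2 * (2 ^ (∑ i, α i) * (nu ψ l f / ‖ψ x‖ * (nu ψ l g / ‖ψ x‖))) := by
          rw [norm_mul]
          exact mul_le_mul (hψ x) this (norm_nonneg _) (by positivity)
      _ = 2 ^ (∑ i, α i) * (nu ψ l f * nu ψ l g) := by field_simp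
      _ ≤ _ := by
          gcongr
          norm_num

/-! ### The algebra of tempered generalized functions -/

/-- The parameter set `(0, 1]`. -/
abbrev Par : Type := Set.Ioc (0 : ℝ) 1

/-- The filter `ε → 0` on `(0, 1]`. -/
def toZero : Filter Par := comap ((↑) : Par → ℝ) (𝓝[>] 0)

theorem pow_isBigO_one (m : ℕ) : (fun ε : Par => (ε : ℝ) ^ m) =O[toZero] fun _ => (1 : ℝ) := by
  refine IsBigO.of_norm_le fun ε => ?_
  rw [Real.norm_of_nonneg (pow_nonneg ε.2.1.le _)]
  exact pow_le_one₀ ε.2.1.le ε.2.2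

theorem zpow_neg_isBigO {m n : ℕ} (h : m ≤ n) :
    (fun ε : Par => (ε : ℝ) ^ (-(m : ℤ))) =O[toZero] fun ε : Par => (ε : ℝ) ^ (-(n : ℤ)) := by
  refine IsBigO.of_norm_le fun ε => ?_
  rw [Real.norm_of_nonneg (zpow_nonneg ε.2.1.le _)]
  exact zpow_le_zpow_right_of_le_one₀ ε.2.1 ε.2.2 (by omega)

theorem nu_add_isLittleO {f g : Par → OM 𝕜 d} {φ : 𝓢(Euc d, 𝕜)} {l : ℕ} {r : Par → ℝ}
    (hf : (fun ε => nu φ l (f ε)) =o[toZero] r) (hg : (fun ε => nu φ l (g ε)) =o[toZero] r) :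
    (fun ε => nu φ l (f ε + g ε)) =o[toZero] r := by
  refine IsBigO.trans_isLittleO (IsBigO.of_norm_le fun ε => ?_) (hf.add hg)
  rw [Real.norm_of_nonneg (nu_nonneg _ _ _)]
  exact nu_add_le _ _ _ _

theorem nu_mul_isLittleO {f g : Par → OM 𝕜 d} {φ ψ : 𝓢(Euc d, 𝕜)} {l : ℕ} {r s : Par → ℝ}
    (hψ : ∀ u v : OM 𝕜 d, nu φ l (u * v) ≤ 2 ^ l * (nu ψ l u * nu ψ l v))
    (hf : (fun ε => nu ψ l (f ε)) =o[toZero] r) (hg : (fun ε => nu ψ l (g ε)) =o[toZero] s) :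
    (fun ε => nu φ l (f ε * g ε)) =o[toZero] fun ε => r ε * s ε := by
  refine IsBigO.trans_isLittleO (IsBigO.of_norm_le fun ε => ?_)
    ((hf.mul hg).const_mul_left (2 ^ l))
  rw [Real.norm_of_nonneg (nu_nonneg _ _ _)]
  exact hψ _ _

theorem const_isLittleO (c : ℝ) :
    (fun _ : Par => c) =o[toZero] fun ε : Par => (ε : ℝ) ^ (-((1 : ℕ) : ℤ)) := by
  have h1 : Tendsto (fun ε : Par => (ε : ℝ)⁻¹) toZero atTop :=
    tendsto_inv_nhdsGT_zero.comp tendsto_comap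
  have h2 : (fun ε : Par => (ε : ℝ) ^ (-((1 : ℕ) : ℤ))) = fun ε : Par => (ε : ℝ)⁻¹ := by
    funext ε; simp
  rw [h2]
  exact isLittleO_const_left.2 (Or.inr (tendsto_norm_atTop_atTop.comp h1))

variable (𝕜 d) in
/-- The algebra `M_{O_M}(ℝ^d)` of moderate families `(f_ε)_{ε ∈ (0,1]}` in `O_M(ℝ^d)`: for all
`φ ∈ S(ℝ^d)` and `l ∈ ℕ` there is `m ∈ ℕ` with `ν_{φ,l}(f_ε) = o(ε^{-m})` as `ε → 0`. -/
def Moderate : Subalgebra 𝕜 (Par → OM 𝕜 d) where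
  carrier := {f | ∀ (φ : 𝓢(Euc d, 𝕜)) (l : ℕ), ∃ m : ℕ,
    (fun ε => nu φ l (f ε)) =o[toZero] fun ε : Par => (ε : ℝ) ^ (-(m : ℤ))}
  mul_mem' := by
    intro f g hf hg φ l
    obtain ⟨ψ, hψ⟩ := exists_nu_mul_le φ l
    obtain ⟨m, hm⟩ := hf ψ l
    obtain ⟨n, hn⟩ := hg ψ l
    refine ⟨m + n, (nu_mul_isLittleO hψ hm hn).congr_right fun ε => ?_⟩
    rw [← zpow_add₀ ε.2.1.ne']
    congr 1
    push_cast
    ring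
  add_mem' := by
    intro f g hf hg φ l
    obtain ⟨m, hm⟩ := hf φ l
    obtain ⟨n, hn⟩ := hg φ l
    exact ⟨max m n, nu_add_isLittleO (hm.trans_isBigO (zpow_neg_isBigO (le_max_left m n)))
      (hn.trans_isBigO (zpow_neg_isBigO (le_max_right m n)))⟩
  algebraMap_mem' := fun c φ l => ⟨1, const_isLittleO (nu φ l (algebraMap 𝕜 (OM 𝕜 d) c))⟩

instance : CommRing (Moderate 𝕜 d) := Subalgebra.toCommRing (R := 𝕜) (A := Par → OM 𝕜 d) _

instance : Algebra 𝕜 (Moderate 𝕜 d) := Subalgebra.algebra _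

variable (𝕜 d) in
/-- The ideal `N_{O_M}(ℝ^d)` of negligible families in `M_{O_M}(ℝ^d)`: for all `φ ∈ S(ℝ^d)`,
`l ∈ ℕ` and `m ∈ ℕ`, `ν_{φ,l}(f_ε) = o(ε^m)` as `ε → 0`. -/
def Negligible : Ideal (Moderate 𝕜 d) where
  carrier := {f | ∀ (φ : 𝓢(Euc d, 𝕜)) (l m : ℕ),
    (fun ε => nu φ l (f.1 ε)) =o[toZero] fun ε : Par => (ε : ℝ) ^ m}
  add_mem' := fun hf hg φ l m => nu_add_isLittleO (hf φ l m) (hg φ l m)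
  zero_mem' := by
    intro φ l m
    have h : nu φ l (0 : OM 𝕜 d) = 0 :=
      le_antisymm (nu_le _ _ _ _ fun x α _ => by simp) (nu_nonneg _ _ _)
    exact (isLittleO_zero _ _).congr_left fun ε => h.symm
  smul_mem' := by
    intro f g hg φ l m
    obtain ⟨ψ, hψ⟩ := exists_nu_mul_le φ l
    obtain ⟨n, hn⟩ := f.2 ψ l
    refine (nu_mul_isLittleO hψ hn (hg ψ l (n + m))).congr_right fun ε => ?_
    rw [← zpow_natCast, ← zpow_natCast, ← zpow_add₀ ε.2.1.ne']
    congr 1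
    push_cast
    ring

/-- Negligible families in `O_M(ℝ^d)` are automatically moderate. -/
theorem mem_moderate_of_negligible {f : Par → OM 𝕜 d}
    (hf : ∀ (φ : 𝓢(Euc d, 𝕜)) (l m : ℕ),
      (fun ε => nu φ l (f ε)) =o[toZero] fun ε : Par => (ε : ℝ) ^ m) : f ∈ Moderate 𝕜 d :=
  fun φ l => ⟨0, (hf φ l 0).congr_right fun ε => by simp⟩

variable (𝕜 d) in
/-- The algebra `G_τ(ℝ^d) = M_{O_M}(ℝ^d) / N_{O_M}(ℝ^d)` of tempered generalized functions. -/
def GTau : Type _ := Moderate 𝕜 d ⧸ Negligible 𝕜 d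

instance : CommRing (GTau 𝕜 d) := inferInstanceAs (CommRing (Moderate 𝕜 d ⧸ Negligible 𝕜 d))

instance : Algebra 𝕜 (GTau 𝕜 d) := inferInstanceAs (Algebra 𝕜 (Moderate 𝕜 d ⧸ Negligible 𝕜 d))

variable (𝕜 d) in
/-- The class `(f_ε)_ε + N_{O_M}(ℝ^d)` of a moderate family. -/
def GTau.mk : Moderate 𝕜 d →ₐ[𝕜] GTau 𝕜 d := Ideal.Quotient.mkₐ 𝕜 (Negligible 𝕜 d)

theorem GTau.mk_surjective : Function.Surjective (GTau.mk 𝕜 d) :=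
  Ideal.Quotient.mkₐ_surjective 𝕜 (Negligible 𝕜 d)

theorem GTau.mk_eq_zero (f : Moderate 𝕜 d) : GTau.mk 𝕜 d f = 0 ↔ f ∈ Negligible 𝕜 d :=
  Ideal.Quotient.eq_zero_iff_mem

theorem Moderate.pd_mem (i : Fin d) (f : Moderate 𝕜 d) :
    (fun ε => OM.pd 𝕜 i (f.1 ε)) ∈ Moderate 𝕜 d := by
  intro φ l
  obtain ⟨m, hm⟩ := f.2 φ (l + 1)
  refine ⟨m, IsBigO.trans_isLittleO (IsBigO.of_norm_le fun ε => ?_) hm⟩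
  rw [Real.norm_of_nonneg (nu_nonneg _ _ _)]
  exact nu_pd_le _ _ _ _

variable (𝕜) in
/-- The componentwise partial derivative `(f_ε)_ε ↦ (∂_i f_ε)_ε` on moderate families. -/
def Moderate.pd (i : Fin d) : Derivation 𝕜 (Moderate 𝕜 d) (Moderate 𝕜 d) :=
  Derivation.mk'
    { toFun := fun f => ⟨fun ε => OM.pd 𝕜 i (f.1 ε), Moderate.pd_mem i f⟩
      map_add' := fun f g => Subtype.ext (funext fun ε => map_add (OM.pd 𝕜 i) (f.1 ε) (g.1 ε))
      map_smul' := fun c f => Subtype.ext (funext fun ε => (OM.pd 𝕜 i).map_smul c (f.1 ε)) }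
    (fun f g => Subtype.ext (funext fun ε => (OM.pd 𝕜 i).leibniz (f.1 ε) (g.1 ε)))

theorem Moderate.pd_negligible (i : Fin d) (f : Moderate 𝕜 d) (hf : f ∈ Negligible 𝕜 d) :
    Moderate.pd 𝕜 i f ∈ Negligible 𝕜 d := by
  intro φ l m
  refine IsBigO.trans_isLittleO (IsBigO.of_norm_le fun ε => ?_) (hf φ (l + 1) m)
  rw [Real.norm_of_nonneg (nu_nonneg _ _ _)]
  exact nu_pd_le _ _ _ _

theorem GTau.mk_pd_eq_zero (i : Fin d) (f : Moderate 𝕜 d) (hf : GTau.mk 𝕜 d f = 0) :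
    GTau.mk 𝕜 d (Moderate.pd 𝕜 i f) = 0 :=
  (GTau.mk_eq_zero _).2 (Moderate.pd_negligible i f ((GTau.mk_eq_zero f).1 hf))

variable (𝕜) in
/-- The partial derivative `∂_i` on `G_τ(ℝ^d)`, defined componentwise on representatives
(see `GTau.pd_mk`). It is a derivation of the algebra `G_τ(ℝ^d)`. -/
def GTau.pd (i : Fin d) : Derivation 𝕜 (GTau 𝕜 d) (GTau 𝕜 d) :=
  Derivation.liftOfSurjective (f := GTau.mk 𝕜 d) GTau.mk_surjective (d := Moderate.pd 𝕜 i)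
    (GTau.mk_pd_eq_zero i)

theorem GTau.pd_mk (i : Fin d) (f : Moderate 𝕜 d) :
    GTau.pd 𝕜 i (GTau.mk 𝕜 d f) = GTau.mk 𝕜 d (Moderate.pd 𝕜 i f) :=
  Derivation.liftOfSurjective_apply (f := GTau.mk 𝕜 d) GTau.mk_surjective
    (d := Moderate.pd 𝕜 i) (GTau.mk_pd_eq_zero i) f

/-- The multi-index derivative `∂^α` on `G_τ(ℝ^d)`. -/
def GTau.deriv (α : Fin d → ℕ) : Module.End 𝕜 (GTau 𝕜 d) :=
  multiDeriv (fun i : Fin d => (GTau.pd 𝕜 i).toLinearMap) α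

theorem const_mem_moderate (u : OM 𝕜 d) : (fun _ : Par => u) ∈ Moderate 𝕜 d :=
  fun φ l => ⟨1, const_isLittleO (nu φ l u)⟩

variable (𝕜 d) in
/-- The map `σ_τ : O_M(ℝ^d) → G_τ(ℝ^d)`, `u ↦ (u)_ε + N_{O_M}(ℝ^d)`, as a morphism of
algebras. -/
def sigmaTau : OM 𝕜 d →ₐ[𝕜] GTau 𝕜 d :=
  (GTau.mk 𝕜 d).comp
    { toFun := fun u => ⟨fun _ => u, const_mem_moderate u⟩
      map_one' := rfl
      map_mul' := fun _ _ => rfl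
      map_zero' := rfl
      map_add' := fun _ _ => rfl
      commutes' := fun _ => rfl }

theorem sigmaTau_apply (u : OM 𝕜 d) :
    sigmaTau 𝕜 d u = GTau.mk 𝕜 d ⟨fun _ => u, const_mem_moderate u⟩ := rfl

/-! ### Tempered distributions -/

variable (𝕜 d) in
/-- The space `S'(ℝ^d)` of `𝕜`-valued tempered distributions; for `𝕜 = ℂ` this is Mathlib's
`𝓢'(ℝ^d, ℂ)`. -/
abbrev TDist : Type _ := 𝓢(Euc d, 𝕜) →Lₚₜ[𝕜] 𝕜

variable (𝕜) in
/-- The distributional partial derivative, `⟨∂_i T, φ⟩ = -⟨T, ∂_i φ⟩`. -/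
def TDist.pd (i : Fin d) : Module.End 𝕜 (TDist 𝕜 d) :=
  (PointwiseConvergenceCLM.precomp 𝕜
    (-LineDeriv.lineDerivOpCLM 𝕜 𝓢(Euc d, 𝕜) (stdVec i : Euc d)) : TDist 𝕜 d →L[𝕜] TDist 𝕜 d)

theorem TDist.pd_apply (i : Fin d) (T : TDist 𝕜 d) (φ : 𝓢(Euc d, 𝕜)) :
    TDist.pd 𝕜 i T φ = -T (∂_{(stdVec i : Euc d)} φ) := by
  rw [← map_neg]; rfl

/-- The multi-index derivative `∂^α` on `S'(ℝ^d)`. -/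
def TDist.deriv (α : Fin d → ℕ) : Module.End 𝕜 (TDist 𝕜 d) :=
  multiDeriv (TDist.pd 𝕜) α

/-- The canonical embedding of `O_M(ℝ^d)` into `S'(ℝ^d)`, `⟨u, φ⟩ = ∫ φ(x) u(x) dx`. -/
def OM.toTDist (u : OM 𝕜 d) : TDist 𝕜 d :=
  ContinuousLinearMap.toPointwiseConvergenceCLM _ _ _ _
    ((SchwartzMap.integralCLM 𝕜 volume) ∘L
      (SchwartzMap.bilinLeftCLM (ContinuousLinearMap.mul 𝕜 𝕜) u.2))

theorem OM.toTDist_apply (u : OM 𝕜 d) (φ : 𝓢(Euc d, 𝕜)) :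
    OM.toTDist u φ = ∫ x, φ x * (u : Euc d → 𝕜) x := rfl

/-- For `φ ∈ S(ℝ^d)` and `x ∈ ℝ^d`, the Schwartz function `y ↦ φ(x - y)`. -/
def reflTranslate (φ : 𝓢(Euc d, 𝕜)) (x : Euc d) : 𝓢(Euc d, 𝕜) :=
  SchwartzMap.compCLMOfAntilipschitz 𝕜 (g := fun y : Euc d => x - y) (K := 1) (by fun_prop)
    (fun _ _ => by simp [edist_dist, dist_eq_norm, norm_sub_rev]) φ

theorem reflTranslate_apply (φ : 𝓢(Euc d, 𝕜)) (x y : Euc d) :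
    reflTranslate φ x y = φ (x - y) := rfl

/-- The convolution of `T ∈ S'(ℝ^d)` and `φ ∈ S(ℝ^d)`, that is the function
`(T * φ)(x) = ⟨T, φ(x - ·)⟩`. -/
def TDist.conv (T : TDist 𝕜 d) (φ : 𝓢(Euc d, 𝕜)) (x : Euc d) : 𝕜 := T (reflTranslate φ x)

/-- The scaled mollifier `ρ_ε(x) = ε^{-d} ρ(x / ε)`. -/
def scaled (ρ : 𝓢(Euc d, 𝕜)) (ε : Par) : 𝓢(Euc d, 𝕜) :=
  (((ε : ℝ) ^ d)⁻¹ : ℝ) • SchwartzMap.compCLMOfContinuousLinearEquiv 𝕜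
    (ContinuousLinearEquiv.smulLeft (Units.mk0 ((ε : ℝ)⁻¹) (inv_ne_zero ε.2.1.ne'))) ρ

theorem scaled_apply (ρ : 𝓢(Euc d, 𝕜)) (ε : Par) (x : Euc d) :
    scaled ρ ε x = (((ε : ℝ) ^ d)⁻¹ : ℝ) • ρ ((ε : ℝ)⁻¹ • x) := rfl

end TemperedGF

end

open TemperedGF

noncomputable section

namespace TemperedGF

universe u

/-! ### Weighted estimates for Schwartz functions -/

section Calculus

/-! Everything rests on one estimate: a tempered distribution `T` is bounded by finitely many
weighted suprema of derivatives (`TDist.exists_bound`). Since `1 + |y| ≤ (1 + |x|)(1 + |x - y|)`,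
this makes `T * φ` polynomially bounded. Applied to Taylor remainders of `φ`, it makes `T * φ`
differentiable with partial derivatives `T * ∂_i φ = (∂_i T) * φ`, so `T * φ` lies in `O_M`. With `φ
= ρ_ε` the weighted suprema grow like a power of `1/ε`, which is moderateness. Derivatives need no
extra work, because `∂^α (T * ρ_ε) = (∂^α T) * ρ_ε`; the same identity shows that `ι_τ` commutes
with derivatives.

Injectivity of `ι_τ` compares two computations of `∫ φ (T * ρ_ε)`. If the family is negligible, the
integral tends to 0. It also equals `T` applied to the convolution of `φ` with the reflected
mollifier (`TDist.apply_sconv`), which converges to `φ` in the Schwartz space because `∫ ρ = 1`;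
hence `T φ = 0`. To move `T` inside the integral, `T` is factored through a Banach space of weighted
jets by Hahn–Banach, where it commutes with Bochner integrals. Injectivity of `σ_τ` follows by
testing with a bump function.

For (iii), `(T_u * ρ_ε)(x) = ∫ ρ(z) u(x - ε z) dz`. As a function of `t = ε` this has derivative `-∑
∫ z_i ρ(z) ∂_i u(x - t z) dz`, a sum of averages of the same type whose kernels `z_i ρ` have all
moments zero. Such averages vanish at `t = 0`, so repeated use of the mean value inequality gives
`O(t^m)` for every `m`, with polynomial growth in `x` (`exists_norm_dilAvg_sub_le`). A Schwartz
factor absorbs that growth. -/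

theorem one_add_norm_le_mul {E : Type*} [SeminormedAddCommGroup E] (z w : E) : 1 + ‖z‖ ≤ (1 + ‖w‖) * (1 + ‖z - w‖) := by
  have h := norm_le_insert' z w
  nlinarith [norm_nonneg w, norm_nonneg (z - w)]

/-- Submultiplicativity of the weight under translation; it transfers a weight from a point to a
translate at the cost of a power of the shift. -/
theorem one_add_norm_pow_le_mul {E : Type*} [SeminormedAddCommGroup E] (z w : E) (N : ℕ) :
    (1 + ‖z‖) ^ N ≤ (1 + ‖w‖) ^ N * (1 + ‖z - w‖) ^ N := by
  rw [← mul_pow]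
  exact pow_le_pow_left₀ (by positivity) (one_add_norm_le_mul z w) N

variable {E F : Type*} [NormedAddCommGroup E] [NormedSpace ℝ E] [NormedAddCommGroup F]
  [NormedSpace ℝ F]

theorem _root_.SchwartzMap.exists_one_add_norm_pow_mul_le (g : 𝓢(E, F)) (k n : ℕ) :
    ∃ C, 0 ≤ C ∧ ∀ z, (1 + ‖z‖) ^ k * ‖iteratedFDeriv ℝ n g z‖ ≤ C :=
  ⟨2 ^ k * ((Finset.Iic (k, n)).sup fun m => SchwartzMap.seminorm ℝ m.1 m.2) g, by positivity,
    fun z => SchwartzMap.one_add_le_sup_seminorm_apply (m := (k, n)) le_rfl le_rfl g z⟩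

/-- Mean value inequality with polynomial weights. -/
theorem one_add_norm_pow_mul_norm_sub_le {f : E → F} (hf : Differentiable ℝ f) {C : ℝ} {N : ℕ}
    (hC : ∀ w, (1 + ‖w‖) ^ N * ‖fderiv ℝ f w‖ ≤ C) (z v : E) :
    (1 + ‖z‖) ^ N * ‖f (z + v) - f z‖ ≤ C * (1 + ‖v‖) ^ N * ‖v‖ := by
  have hC0 : 0 ≤ C := le_trans (by positivity) (hC 0)
  have hpos : 0 < (1 + ‖z‖) ^ N := by positivity
  -- On this ball the weights at `w` and `z` differ by a factor of at most `(1 + ‖v‖) ^ N`, so the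
  -- weighted bound becomes a constant bound.
  have key : ∀ w ∈ Metric.closedBall z ‖v‖, ‖fderiv ℝ f w‖ ≤ C * (1 + ‖v‖) ^ N / (1 + ‖z‖) ^ N := by
    intro w hw
    rw [mem_closedBall_iff_norm'] at hw
    rw [le_div_iff₀' hpos]
    calc (1 + ‖z‖) ^ N * ‖fderiv ℝ f w‖
        ≤ ((1 + ‖w‖) ^ N * (1 + ‖z - w‖) ^ N) * ‖fderiv ℝ f w‖ := by
          gcongr
          exact one_add_norm_pow_le_mul z w N
      _ = ((1 + ‖w‖) ^ N * ‖fderiv ℝ f w‖) * (1 + ‖z - w‖) ^ N := by ring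
      _ ≤ C * (1 + ‖v‖) ^ N := by
          gcongr
          exact hC w
  have h := Convex.norm_image_sub_le_of_norm_fderiv_le (𝕜 := ℝ) (fun w _ => hf w) key
    (convex_closedBall z ‖v‖) (Metric.mem_closedBall_self (norm_nonneg v))
    (show z + v ∈ Metric.closedBall z ‖v‖ by simp)
  rw [add_sub_cancel_left, div_mul_eq_mul_div, le_div_iff₀' hpos] at h
  exact h

/-- First order Taylor estimate with polynomial weights. -/
theorem one_add_norm_pow_mul_norm_sub_sub_le {f : E → F} (hf : Differentiable ℝ f)
    (hf' : Differentiable ℝ (fderiv ℝ f)) {C : ℝ} {N : ℕ}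
    (hC : ∀ w, (1 + ‖w‖) ^ N * ‖fderiv ℝ (fderiv ℝ f) w‖ ≤ C) (z v : E) :
    (1 + ‖z‖) ^ N * ‖f (z + v) - f z - fderiv ℝ f z v‖ ≤ C * (1 + ‖v‖) ^ N * ‖v‖ ^ 2 := by
  have hC0 : 0 ≤ C := le_trans (by positivity) (hC 0)
  have hpos : 0 < (1 + ‖z‖) ^ N := by positivity
  have key : ∀ w ∈ Metric.closedBall z ‖v‖, ‖fderiv ℝ f w - fderiv ℝ f z‖ ≤
      C * (1 + ‖v‖) ^ N * ‖v‖ / (1 + ‖z‖) ^ N := by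
    intro w hw
    rw [mem_closedBall_iff_norm] at hw
    rw [le_div_iff₀' hpos]
    have := one_add_norm_pow_mul_norm_sub_le hf' hC z (w - z)
    rw [add_sub_cancel] at this
    exact this.trans (by gcongr)
  have h := Convex.norm_image_sub_le_of_norm_fderiv_le' (𝕜 := ℝ) (φ := fderiv ℝ f z)
    (fun w _ => hf w) key
    (convex_closedBall z ‖v‖) (Metric.mem_closedBall_self (norm_nonneg v))
    (show z + v ∈ Metric.closedBall z ‖v‖ by simp)
  rw [add_sub_cancel_left, div_mul_eq_mul_div, le_div_iff₀' hpos] at h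
  exact h.trans (by rw [sq, mul_assoc _ ‖v‖])

/-- The first order Taylor remainder of a Schwartz function, as a Schwartz function. -/
def taylorRem (φ : 𝓢(E, F)) (v : E) : 𝓢(E, F) :=
  SchwartzMap.compSubConstCLM ℝ (-v) φ - φ - ∂_{v} φ

theorem taylorRem_apply (φ : 𝓢(E, F)) (v z : E) :
    taylorRem φ v z = φ (z + v) - φ z - fderiv ℝ φ z v := by
  simp [taylorRem, SchwartzMap.lineDerivOp_apply_eq_fderiv]

/-- Symmetry of the second derivative is what makes the linear term match. The identity reduces
estimates on derivatives of the remainder to the remainder itself. -/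
theorem fderiv_taylorRem (φ : 𝓢(E, F)) (v : E) :
    fderiv ℝ (taylorRem φ v) = taylorRem (SchwartzMap.fderivCLM ℝ E F φ) v := by
  funext z
  have h1 : (taylorRem φ v : E → F) = fun z => φ (z + v) - φ z - fderiv ℝ φ z v := by
    funext z; exact taylorRem_apply φ v z
  have h2 : Differentiable ℝ (fderiv ℝ φ) := (SchwartzMap.fderivCLM ℝ E F φ).differentiable
  have hs : IsSymmSndFDerivAt ℝ (φ : E → F) z :=
    ((φ.smooth ⊤).contDiffAt (x := z)).isSymmSndFDerivAt
      (by simpa using (WithTop.coe_le_coe.2 le_top : ((2 : ℕ∞) : WithTop ℕ∞) ≤ ∞))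
  have h3 : (SchwartzMap.fderivCLM ℝ E F φ : E → E →L[ℝ] F) = fderiv ℝ φ := by
    funext z; simp
  rw [taylorRem_apply, h1, h3]
  have hd : DifferentiableAt ℝ (fun z => φ (z + v)) z := by
    exact φ.differentiable.comp (differentiable_id.add_const v) z
  rw [fderiv_fun_sub (hd.fun_sub φ.differentiableAt)
      ((h2 z).clm_apply (differentiableAt_const v)),
    fderiv_fun_sub hd φ.differentiableAt, fderiv_comp_add_right]
  congr 1
  ext w
  rw [fderiv_clm_apply (h2 z) (differentiableAt_const v)]
  simp [hs w v]

end Calculus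

theorem exists_taylorRem_le {d : ℕ} (N n : ℕ) :
    -- The target space is quantified inside the induction, since the inductive step passes to the
    -- derivative of `φ`, with values in `Euc d →L[ℝ] F`.
    ∀ {F : Type u} [NormedAddCommGroup F] [NormedSpace ℝ F] (φ : 𝓢(Euc d, F)),
    ∃ C, 0 ≤ C ∧ ∀ v z, (1 + ‖z‖) ^ N * ‖iteratedFDeriv ℝ n (taylorRem φ v) z‖ ≤
      C * (1 + ‖v‖) ^ N * ‖v‖ ^ 2 := by
  induction n with
  | zero =>
    intro F _ _ φ
    have h2 : Differentiable ℝ (fderiv ℝ φ) := (SchwartzMap.fderivCLM ℝ (Euc d) F φ).differentiable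
    obtain ⟨C, hC0, hC⟩ := φ.exists_one_add_norm_pow_mul_le N 2
    refine ⟨C, hC0, fun v z => ?_⟩
    rw [norm_iteratedFDeriv_zero, taylorRem_apply]
    refine one_add_norm_pow_mul_norm_sub_sub_le φ.differentiable h2 (fun w => ?_) z v
    rw [← norm_iteratedFDeriv_one, norm_iteratedFDeriv_fderiv]
    exact hC w
  | succ n ih =>
    intro F _ _ φ
    obtain ⟨C, hC0, hC⟩ := ih (SchwartzMap.fderivCLM ℝ (Euc d) F φ)
    refine ⟨C, hC0, fun v z => ?_⟩
    rw [← norm_iteratedFDeriv_fderiv, fderiv_taylorRem]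
    exact hC v z

/-! ### Convolution of a tempered distribution with a Schwartz function -/

variable {𝕜 : Type*} [RCLike 𝕜] {d : ℕ}

/-- A continuous linear functional on the Schwartz space is bounded by weighted suprema of finitely
many derivatives. -/
theorem TDist.exists_bound (T : TDist 𝕜 d) : ∃ (C : ℝ) (N : ℕ), 0 ≤ C ∧
    ∀ (ψ : 𝓢(Euc d, 𝕜)) (M : ℝ), 0 ≤ M →
      (∀ n ≤ N, ∀ y, (1 + ‖y‖) ^ N * ‖iteratedFDeriv ℝ n ψ y‖ ≤ M) → ‖T ψ‖ ≤ C * M := by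
  let q : Seminorm 𝕜 𝓢(Euc d, 𝕜) := (normSeminorm 𝕜 𝕜).comp T.toLinearMap
  have hq : Continuous q := continuous_norm.comp T.continuous
  obtain ⟨s, C, -, hs⟩ := Seminorm.bound_of_continuous (schwartz_withSeminorms 𝕜 (Euc d) 𝕜) q hq
  -- The sum dominates both the weight exponent and the order of differentiation of every seminorm
  -- in `s`.
  let N : ℕ := s.sup fun m => m.1 + m.2
  refine ⟨C, N, C.2, fun ψ M hM h => (hs ψ).trans ?_⟩
  refine mul_le_mul_of_nonneg_left (Seminorm.finset_sup_apply_le hM fun m hm => ?_) C.2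
  have hmN : m.1 + m.2 ≤ N := Finset.le_sup (f := fun m : ℕ × ℕ => m.1 + m.2) hm
  refine SchwartzMap.seminorm_le_bound 𝕜 m.1 m.2 ψ hM fun y => ?_
  refine le_trans ?_ (h m.2 (by omega) y)
  gcongr
  calc ‖y‖ ^ m.1 ≤ (1 + ‖y‖) ^ m.1 := by gcongr; linarith
    _ ≤ (1 + ‖y‖) ^ N := pow_le_pow_right₀ (by linarith [norm_nonneg y]) (by omega)

/-- The map `φ ↦ φ(x - ·)` as a linear map. -/
def reflTranslateCLM (x : Euc d) : 𝓢(Euc d, 𝕜) →L[𝕜] 𝓢(Euc d, 𝕜) :=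
  SchwartzMap.compCLMOfAntilipschitz 𝕜 (g := fun y : Euc d => x - y) (K := 1) (by fun_prop)
    (fun _ _ => by simp [edist_dist, dist_eq_norm, norm_sub_rev])

theorem reflTranslateCLM_apply (x : Euc d) (φ : 𝓢(Euc d, 𝕜)) :
    reflTranslateCLM x φ = reflTranslate φ x := rfl

theorem norm_iteratedFDeriv_reflTranslate (φ : 𝓢(Euc d, 𝕜)) (x y : Euc d) (n : ℕ) :
    ‖iteratedFDeriv ℝ n (reflTranslate φ x) y‖ = ‖iteratedFDeriv ℝ n φ (x - y)‖ := by
  have h : (reflTranslate φ x : Euc d → 𝕜) =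
      fun y => (fun z => φ (x + z)) ((LinearIsometryEquiv.neg ℝ : Euc d ≃ₗᵢ[ℝ] Euc d) y) := by
    funext y
    simp [reflTranslate_apply, sub_eq_add_neg]
  rw [h]
  have := (LinearIsometryEquiv.neg ℝ : Euc d ≃ₗᵢ[ℝ] Euc d).norm_iteratedFDeriv_comp_right
    (𝕜 := ℝ) (fun z => φ (x + z)) y n
  refine this.trans ?_
  rw [iteratedFDeriv_comp_add_left]
  simp [sub_eq_add_neg]

/-- Uniform polynomial bound for convolutions with a fixed tempered distribution. -/
theorem TDist.exists_conv_bound (T : TDist 𝕜 d) : ∃ (C : ℝ) (N : ℕ), 0 ≤ C ∧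
    ∀ (φ : 𝓢(Euc d, 𝕜)) (M : ℝ), 0 ≤ M →
      (∀ n ≤ N, ∀ y, (1 + ‖y‖) ^ N * ‖iteratedFDeriv ℝ n φ y‖ ≤ M) →
      ∀ x, ‖T.conv φ x‖ ≤ C * M * (1 + ‖x‖) ^ N := by
  obtain ⟨C, N, hC, h⟩ := T.exists_bound
  refine ⟨C, N, hC, fun φ M hM hφ x => ?_⟩
  rw [mul_assoc]
  refine h _ _ (by positivity) fun n hn y => ?_
  rw [norm_iteratedFDeriv_reflTranslate]
  calc (1 + ‖y‖) ^ N * ‖iteratedFDeriv ℝ n φ (x - y)‖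
      ≤ ((1 + ‖x‖) ^ N * (1 + ‖x - y‖) ^ N) * ‖iteratedFDeriv ℝ n φ (x - y)‖ := by
        gcongr
        rw [norm_sub_rev]
        exact one_add_norm_pow_le_mul y x N
    _ = ((1 + ‖x - y‖) ^ N * ‖iteratedFDeriv ℝ n φ (x - y)‖) * (1 + ‖x‖) ^ N := by ring
    _ ≤ M * (1 + ‖x‖) ^ N := by
        gcongr
        exact hφ n hn _

theorem _root_.SchwartzMap.exists_uniform_one_add_norm_pow_mul_le {E F : Type*}
    [NormedAddCommGroup E] [NormedSpace ℝ E] [NormedAddCommGroup F] [NormedSpace ℝ F]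
    (φ : 𝓢(E, F)) (N : ℕ) :
    ∃ M, 0 ≤ M ∧ ∀ n ≤ N, ∀ y, (1 + ‖y‖) ^ N * ‖iteratedFDeriv ℝ n φ y‖ ≤ M :=
  ⟨2 ^ N * ((Finset.Iic (N, N)).sup fun m => SchwartzMap.seminorm ℝ m.1 m.2) φ, by positivity,
    fun n hn z => SchwartzMap.one_add_le_sup_seminorm_apply (m := (N, N)) le_rfl hn φ z⟩

theorem TDist.exists_norm_conv_le (T : TDist 𝕜 d) (φ : 𝓢(Euc d, 𝕜)) :
    ∃ (C : ℝ) (N : ℕ), 0 ≤ C ∧ ∀ x, ‖T.conv φ x‖ ≤ C * (1 + ‖x‖) ^ N := by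
  obtain ⟨C, N, hC, h⟩ := T.exists_conv_bound
  obtain ⟨M, hM, hφ⟩ := φ.exists_uniform_one_add_norm_pow_mul_le N
  exact ⟨C * M, N, by positivity, h φ M hM hφ⟩

/-- The derivative of `T * φ`. -/
def TDist.convFDeriv (T : TDist 𝕜 d) (φ : 𝓢(Euc d, 𝕜)) (x : Euc d) : Euc d →L[ℝ] 𝕜 :=
  ∑ i : Fin d, ((ContinuousLinearMap.smulRightL ℝ (Euc d) 𝕜)
    (EuclideanSpace.proj i : Euc d →L[ℝ] ℝ)) (T.conv (∂_{(stdVec i : Euc d)} φ) x)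

/-- The coefficients are cast to `𝕜` so that the `𝕜`-linear functional `T` can be moved past them.
-/
theorem lineDeriv_eq_sum (φ : 𝓢(Euc d, 𝕜)) (v : Euc d) :
    ∂_{v} φ = ∑ i : Fin d, ((v i : ℝ) : 𝕜) • ∂_{(stdVec i : Euc d)} φ := by
  ext x
  have hv : v = ∑ i : Fin d, v i • (stdVec i : Euc d) := by
    have := (EuclideanSpace.basisFun (Fin d) ℝ).sum_repr v
    simpa using this.symm
  rw [_root_.sum_apply, SchwartzMap.lineDerivOp_apply_eq_fderiv]
  conv_lhs => rw [hv]
  rw [map_sum]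
  refine Finset.sum_congr rfl fun i _ => ?_
  rw [map_smul]
  simp [SchwartzMap.lineDerivOp_apply_eq_fderiv, RCLike.real_smul_eq_coe_mul]

theorem TDist.conv_lineDeriv_eq (T : TDist 𝕜 d) (φ : 𝓢(Euc d, 𝕜)) (x v : Euc d) :
    T.conv (∂_{v} φ) x = T.convFDeriv φ x v := by
  change T (reflTranslateCLM x (∂_{v} φ)) = _
  rw [lineDeriv_eq_sum, map_sum, map_sum]
  simp only [map_smul, TDist.convFDeriv, _root_.sum_apply]
  refine Finset.sum_congr rfl fun i _ => ?_
  simp [RCLike.real_smul_eq_coe_mul, reflTranslateCLM_apply, TDist.conv]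

/-- The Taylor remainder of `T * φ` is the convolution of `T` with the Taylor remainder of `φ`,
whose weighted derivatives are `O(‖v‖ ^ 2)`. -/
theorem TDist.hasFDerivAt_conv (T : TDist 𝕜 d) (φ : 𝓢(Euc d, 𝕜)) (x : Euc d) :
    HasFDerivAt (T.conv φ) (T.convFDeriv φ x) x := by
  obtain ⟨C, N, hC, h⟩ := T.exists_conv_bound
  choose B hB0 hB using fun n : ℕ => exists_taylorRem_le N n φ
  let A : ℝ := ∑ n ∈ Finset.range (N + 1), B n
  have hBA : ∀ n ≤ N, B n ≤ A := fun n hn =>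
    Finset.single_le_sum (f := B) (fun n _ => hB0 n) (Finset.mem_range.2 (by omega))
  have hA : 0 ≤ A := Finset.sum_nonneg fun n _ => hB0 n
  -- `A` bounds the remainder constants of all orders up to `N`, and `2 ^ N` bounds `(1 + ‖v‖) ^ N`
  -- for `‖v‖ ≤ 1`.
  have key : ∀ v : Euc d, ‖v‖ ≤ 1 → ‖T.conv φ (x + v) - T.conv φ x - T.convFDeriv φ x v‖ ≤
      (C * (A * 2 ^ N) * (1 + ‖x‖) ^ N) * ‖v‖ ^ 2 := by
    intro v hv
    have e : T.conv φ (x + v) - T.conv φ x - T.convFDeriv φ x v = T.conv (taylorRem φ v) x := by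
      rw [← TDist.conv_lineDeriv_eq]
      have e2 : reflTranslate φ (x + v) =
          reflTranslateCLM x (SchwartzMap.compSubConstCLM ℝ (-v) φ) := by
        ext y
        simp only [reflTranslateCLM_apply, reflTranslate_apply, SchwartzMap.compSubConstCLM_apply]
        congr 1
        abel
      unfold TDist.conv
      rw [e2, ← reflTranslateCLM_apply, ← reflTranslateCLM_apply, ← reflTranslateCLM_apply,
        taylorRem, map_sub, map_sub, map_sub, map_sub]
    rw [e]
    refine (h _ (A * 2 ^ N * ‖v‖ ^ 2) (by positivity) (fun n hn y => ?_) x).trans (le_of_eq (by ring))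
    refine (hB n v y).trans ?_
    gcongr
    · exact hBA n hn
    · linarith
  rw [hasFDerivAt_iff_isLittleO_nhds_zero]
  refine IsBigO.trans_isLittleO (g := fun v : Euc d => ‖v‖ ^ 2) ?_ ?_
  · refine IsBigO.of_bound (C * (A * 2 ^ N) * (1 + ‖x‖) ^ N) ?_
    filter_upwards [Metric.closedBall_mem_nhds (0 : Euc d) one_pos] with v hv
    rw [norm_pow, norm_norm]
    exact key v (by simpa using hv)
  · have := (isLittleO_norm_pow_id (E' := Euc d) one_lt_two)
    exact this

/-- Induction works because the derivative of `T * φ` is a finite sum of fixed linear maps applied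
to `T * ∂_i φ`, again convolutions with Schwartz functions. -/
theorem TDist.contDiff_conv (T : TDist 𝕜 d) (n : ℕ) :
    ∀ φ : 𝓢(Euc d, 𝕜), ContDiff ℝ n (T.conv φ) ∧
      ∃ (k : ℕ) (C : ℝ), ∀ x, ‖iteratedFDeriv ℝ n (T.conv φ) x‖ ≤ C * (1 + ‖x‖) ^ k := by
  induction n with
  | zero =>
    intro φ
    refine ⟨contDiff_zero.2 (continuous_iff_continuousAt.2 fun x =>
      (T.hasFDerivAt_conv φ x).continuousAt), ?_⟩
    obtain ⟨C, N, -, h⟩ := T.exists_norm_conv_le φ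
    exact ⟨N, C, fun x => by simpa using h x⟩
  | succ n ih =>
    intro φ
    have hf : fderiv ℝ (T.conv φ) = T.convFDeriv φ := funext fun x => (T.hasFDerivAt_conv φ x).fderiv
    let Λ : Fin d → 𝕜 →L[ℝ] Euc d →L[ℝ] 𝕜 := fun i =>
      ContinuousLinearMap.smulRightL ℝ (Euc d) 𝕜 (EuclideanSpace.proj i : Euc d →L[ℝ] ℝ)
    have hf2 : fderiv ℝ (T.conv φ) =
        fun x => ∑ i : Fin d, (Λ i ∘ T.conv (∂_{(stdVec i : Euc d)} φ)) x := by
      rw [hf]; rfl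
    have hc : ∀ i, ContDiff ℝ n (Λ i ∘ T.conv (∂_{(stdVec i : Euc d)} φ)) := fun i =>
      (Λ i).contDiff.comp (ih _).1
    refine ⟨?_, ?_⟩
    · push_cast
      rw [contDiff_succ_iff_fderiv]
      refine ⟨fun x => (T.hasFDerivAt_conv φ x).differentiableAt, by simp, ?_⟩
      rw [hf2]
      exact ContDiff.sum fun i _ => hc i
    · choose k C hkC using fun i : Fin d => (ih (∂_{(stdVec i : Euc d)} φ)).2
      have hC0 : ∀ i, 0 ≤ C i := fun i => by
        have := (norm_nonneg _).trans (hkC i 0)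
        simpa using this
      refine ⟨∑ i, k i, ∑ i, ‖Λ i‖ * C i, fun x => ?_⟩
      rw [← norm_iteratedFDeriv_fderiv, hf2, iteratedFDeriv_fun_sum_apply fun i _ => (hc i).contDiffAt,
        Finset.sum_mul]
      refine norm_sum_le_of_le _ fun i _ => ?_
      rw [(Λ i).iteratedFDeriv_comp_left (ih _).1.contDiffAt le_rfl]
      refine ((Λ i).norm_compContinuousMultilinearMap_le _).trans ?_
      rw [mul_assoc]
      refine mul_le_mul_of_nonneg_left ((hkC i x).trans ?_) (norm_nonneg _)
      refine mul_le_mul_of_nonneg_left (pow_le_pow_right₀ (by linarith [norm_nonneg x]) ?_) (hC0 i)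
      exact Finset.single_le_sum (f := k) (fun _ _ => Nat.zero_le _) (Finset.mem_univ i)

theorem TDist.conv_mem_OM (T : TDist 𝕜 d) (φ : 𝓢(Euc d, 𝕜)) : T.conv φ ∈ OM 𝕜 d :=
  ⟨contDiff_infty.2 fun n => (T.contDiff_conv n φ).1, fun n => (T.contDiff_conv n φ).2⟩

/-- The convolution `T * φ` as an element of `O_M`. -/
def TDist.convOM (T : TDist 𝕜 d) (φ : 𝓢(Euc d, 𝕜)) : OM 𝕜 d := ⟨T.conv φ, T.conv_mem_OM φ⟩

theorem TDist.convOM_apply (T : TDist 𝕜 d) (φ : 𝓢(Euc d, 𝕜)) (x : Euc d) :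
    (T.convOM φ : Euc d → 𝕜) x = T (reflTranslate φ x) := rfl

/-- The sign in the distributional derivative cancels the sign from differentiating `y ↦ φ(x - y)`.
-/
theorem TDist.pd_convOM (T : TDist 𝕜 d) (φ : 𝓢(Euc d, 𝕜)) (i : Fin d) :
    OM.pd 𝕜 i (T.convOM φ) = (TDist.pd 𝕜 i T).convOM φ := by
  ext x
  rw [OM.pd_apply, TDist.convOM_apply, TDist.pd_apply]
  change fderiv ℝ (T.conv φ) x (stdVec i) = _
  rw [(T.hasFDerivAt_conv φ x).fderiv, ← TDist.conv_lineDeriv_eq, ← map_neg]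
  unfold TDist.conv
  congr 1
  ext y
  rw [_root_.neg_apply, reflTranslate_apply, SchwartzMap.lineDerivOp_apply_eq_fderiv,
    SchwartzMap.lineDerivOp_apply_eq_fderiv]
  have h : HasFDerivAt (reflTranslate φ x) _ y :=
    (φ.hasFDerivAt (x - y)).comp y ((hasFDerivAt_id y).const_sub x)
  rw [h.fderiv]
  simp

/-- Multi-index derivatives are compositions of partial ones, so a map that commutes with the latter
needs no additivity. This serves `T ↦ T * φ`, `u ↦ T_u`, `σ_τ` and `ι_τ` alike. -/
theorem multiDeriv_intertwine {X Y : Type*} [AddCommGroup X] [Module 𝕜 X]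
    [AddCommGroup Y] [Module 𝕜 Y] (f : X → Y) (D : Fin d → Module.End 𝕜 X)
    (D' : Fin d → Module.End 𝕜 Y) (h : ∀ i x, f (D i x) = D' i (f x)) (α : Fin d → ℕ) (x : X) :
    f (multiDeriv D α x) = multiDeriv D' α (f x) := by
  have hp : ∀ i n x, f ((D i ^ n) x) = (D' i ^ n) (f x) := by
    intro i n
    induction n with
    | zero => intro x; simp
    | succ n ih => intro x; rw [pow_succ, pow_succ, Module.End.mul_apply, Module.End.mul_apply, ih, h]
  unfold multiDeriv
  have hl : ∀ (l : List (Fin d)) (x : X), f ((l.map fun i => D i ^ α i).prod x) =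
      (l.map fun i => D' i ^ α i).prod (f x) := by
    intro l
    induction l with
    | nil => intro x; simp
    | cons i l ih => intro x; simp [hp, ih]
  simpa [List.ofFn_eq_map] using hl (List.finRange d) x

theorem TDist.deriv_convOM (T : TDist 𝕜 d) (φ : 𝓢(Euc d, 𝕜)) (α : Fin d → ℕ) :
    OM.deriv α (T.convOM φ) = (TDist.deriv α T).convOM φ :=
  (multiDeriv_intertwine (fun S : TDist 𝕜 d => S.convOM φ) (TDist.pd 𝕜)
    (fun i => (OM.pd 𝕜 i : OM 𝕜 d →ₗ[𝕜] OM 𝕜 d)) (fun i S => (S.pd_convOM φ i).symm) α T).symm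

/-! ### Convolution of Schwartz functions -/

section Convolution

theorem integrable_smul_comp_sub {F : Type*} [NormedAddCommGroup F] [NormedSpace 𝕜 F]
    {h : Euc d → 𝕜} (hh : Integrable h) {G : Euc d → F}
    (hG : Continuous G) {C : ℝ} (hC : ∀ z, ‖G z‖ ≤ C) (y : Euc d) :
    Integrable fun x => h x • G (y - x) := by
  refine Integrable.mono' (hh.norm.mul_const C)
    (hh.aestronglyMeasurable.smul (by fun_prop)) (Eventually.of_forall fun x => ?_)
  rw [norm_smul]
  exact mul_le_mul_of_nonneg_left (hC _) (norm_nonneg _)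

variable {F : Type*} [NormedAddCommGroup F] [NormedSpace ℝ F] [NormedSpace 𝕜 F]
  [SMulCommClass ℝ 𝕜 F]

theorem hasFDerivAt_integral_smul_comp_sub {h : Euc d → 𝕜} (hh : Integrable h) {G : Euc d → F}
    (hG : Differentiable ℝ G) (hG' : Continuous (fderiv ℝ G)) {C C' : ℝ} (hC : ∀ z, ‖G z‖ ≤ C)
    (hC' : ∀ z, ‖fderiv ℝ G z‖ ≤ C') (y : Euc d) :
    HasFDerivAt (fun y => ∫ x, h x • G (y - x)) (∫ x, h x • fderiv ℝ G (y - x)) y := by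
  refine hasFDerivAt_integral_of_dominated_of_fderiv_le (s := Set.univ) (𝕜 := ℝ)
    (bound := fun x => ‖h x‖ * C') (F' := fun y x => h x • fderiv ℝ G (y - x)) univ_mem
    (Eventually.of_forall fun y => (integrable_smul_comp_sub hh hG.continuous hC y).1)
    (integrable_smul_comp_sub hh hG.continuous hC y)
    (integrable_smul_comp_sub hh hG' hC' y).1
    (Eventually.of_forall fun x y _ => ?_) (hh.norm.mul_const C')
    (Eventually.of_forall fun x y _ => ?_)
  · rw [norm_smul]
    exact mul_le_mul_of_nonneg_left (hC' _) (norm_nonneg _)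
  · have := (hG (y - x)).hasFDerivAt.comp y ((hasFDerivAt_id y).sub_const x)
    exact this.const_smul (h x)

end Convolution

theorem _root_.SchwartzMap.integrable_one_add_norm_pow_mul (h : 𝓢(Euc d, 𝕜)) (k : ℕ) :
    Integrable fun x : Euc d => (1 + ‖x‖) ^ k * ‖h x‖ := by
  refine (integrable_finsetSum (Finset.range (k + 1)) fun m _ =>
    (h.integrable_pow_mul volume m).const_mul ((k.choose m : ℝ))).congr
      (Eventually.of_forall fun x => ?_)
  simp only
  rw [add_comm 1 ‖x‖, add_pow, Finset.sum_mul]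
  refine Finset.sum_congr rfl fun m _ => ?_
  simp only [one_pow, mul_one]
  ring

theorem _root_.SchwartzMap.exists_norm_iteratedFDeriv_le {E F : Type*}
    [NormedAddCommGroup E] [NormedSpace ℝ E] [NormedAddCommGroup F] [NormedSpace ℝ F]
    (g : 𝓢(E, F)) (n : ℕ) : ∃ C, ∀ z, ‖iteratedFDeriv ℝ n g z‖ ≤ C := by
  obtain ⟨C, -, hC⟩ := g.exists_one_add_norm_pow_mul_le 0 n
  exact ⟨C, fun z => by simpa using hC z⟩

/-- All derivatives fall on `g`, whose derivatives are bounded, so domination only needs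
integrability of `h`. -/
theorem iteratedFDeriv_integral_smul_comp_sub {h : Euc d → 𝕜} (hh : Integrable h)
    (g : 𝓢(Euc d, 𝕜)) (n : ℕ) :
    iteratedFDeriv ℝ n (fun y => ∫ x, h x * g (y - x)) =
      (fun y => ∫ x, h x • iteratedFDeriv ℝ n g (y - x)) ∧
    Differentiable ℝ (fun y => ∫ x, h x • iteratedFDeriv ℝ n g (y - x)) := by
  have hd : ∀ m, Differentiable ℝ (iteratedFDeriv ℝ m g) := fun m =>
    (g.smooth ⊤).differentiable_iteratedFDeriv (mod_cast WithTop.coe_lt_top _)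
  have hc : ∀ m, Continuous (fderiv ℝ (iteratedFDeriv ℝ m g)) := fun m => by
    have h1 : ContDiff ℝ 1 (iteratedFDeriv ℝ m g) :=
      (g.smooth ⊤).iteratedFDeriv_right (mod_cast le_top)
    exact h1.continuous_fderiv (by norm_num)
  have hD : ∀ m y, HasFDerivAt (fun y => ∫ x, h x • iteratedFDeriv ℝ m g (y - x))
      (∫ x, h x • fderiv ℝ (iteratedFDeriv ℝ m g) (y - x)) y := by
    intro m y
    obtain ⟨C, hC⟩ := g.exists_norm_iteratedFDeriv_le m
    obtain ⟨C', hC'⟩ := g.exists_norm_iteratedFDeriv_le (m + 1)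
    exact hasFDerivAt_integral_smul_comp_sub hh (hd m) (hc m) hC
      (fun z => by rw [norm_fderiv_iteratedFDeriv]; exact hC' z) y
  refine ⟨?_, fun y => (hD n y).differentiableAt⟩
  induction n with
  | zero =>
    funext y
    have h1 : ∀ x, h x • iteratedFDeriv ℝ 0 g (y - x) =
        (continuousMultilinearCurryFin0 ℝ (Euc d) 𝕜).symm (h x * g (y - x)) := by
      intro x
      ext m
      simp
    simp only [h1]
    rw [← LinearIsometryEquiv.coe_toContinuousLinearEquiv, ContinuousLinearEquiv.integral_comp_comm]
    ext m
    simp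
  | succ n ih =>
    funext y
    rw [iteratedFDeriv_succ_eq_comp_left, ih, Function.comp_apply, (hD n y).fderiv]
    have h1 : ∀ x, h x • iteratedFDeriv ℝ (n + 1) g (y - x) =
        (continuousMultilinearCurryLeftEquiv ℝ (fun _ : Fin (n + 1) => Euc d) 𝕜).symm
          (h x • fderiv ℝ (iteratedFDeriv ℝ n g) (y - x)) := by
      intro x
      rw [iteratedFDeriv_succ_eq_comp_left]
      ext m
      simp
    simp only [h1]
    have h2 := ContinuousLinearEquiv.integral_comp_comm (𝕜 := ℝ) (μ := (volume : Measure (Euc d)))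
      (E := Euc d →L[ℝ] Euc d [×n]→L[ℝ] 𝕜) (F := Euc d [×(n + 1)]→L[ℝ] 𝕜)
      (continuousMultilinearCurryLeftEquiv ℝ
      (fun _ : Fin (n + 1) => Euc d) 𝕜).symm.toContinuousLinearEquiv
      (fun x => h x • fderiv ℝ (iteratedFDeriv ℝ n g) (y - x))
    exact h2.symm

/-- The convolution of two Schwartz functions. -/
def sconv (h g : 𝓢(Euc d, 𝕜)) : 𝓢(Euc d, 𝕜) where
  toFun y := ∫ x, h x * g (y - x)
  smooth' := contDiff_of_differentiable_iteratedFDeriv fun m _ => by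
    obtain ⟨h1, h2⟩ := iteratedFDeriv_integral_smul_comp_sub h.integrable g m
    rw [h1]
    exact h2
  decay' := by
    intro k n
    obtain ⟨C, hC0, hC⟩ := g.exists_one_add_norm_pow_mul_le k n
    have hint := h.integrable_one_add_norm_pow_mul k
    refine ⟨(∫ x, (1 + ‖x‖) ^ k * ‖h x‖) * C, fun y => ?_⟩
    rw [(iteratedFDeriv_integral_smul_comp_sub h.integrable g n).1]
    calc ‖y‖ ^ k * ‖∫ x, h x • iteratedFDeriv ℝ n g (y - x)‖
        ≤ (1 + ‖y‖) ^ k * ‖∫ x, h x • iteratedFDeriv ℝ n g (y - x)‖ := by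
          gcongr; linarith
      _ = ‖∫ x, ((1 + ‖y‖) ^ k : ℝ) • h x • iteratedFDeriv ℝ n g (y - x)‖ := by
          rw [integral_smul, norm_smul, Real.norm_of_nonneg (by positivity)]
      _ ≤ ∫ x, (1 + ‖x‖) ^ k * ‖h x‖ * C := by
          refine norm_integral_le_of_norm_le (hint.mul_const C) (Eventually.of_forall fun x => ?_)
          rw [norm_smul, norm_smul, Real.norm_of_nonneg (by positivity)]
          calc (1 + ‖y‖) ^ k * (‖h x‖ * ‖iteratedFDeriv ℝ n g (y - x)‖)
              ≤ ((1 + ‖x‖) ^ k * (1 + ‖y - x‖) ^ k) *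
                  (‖h x‖ * ‖iteratedFDeriv ℝ n g (y - x)‖) := by
                gcongr
                exact one_add_norm_pow_le_mul y x k
            _ = (1 + ‖x‖) ^ k * ‖h x‖ *
                  ((1 + ‖y - x‖) ^ k * ‖iteratedFDeriv ℝ n g (y - x)‖) := by ring
            _ ≤ _ := by
                gcongr
                exact hC _
      _ = _ := integral_mul_const _ _

theorem sconv_apply (h g : 𝓢(Euc d, 𝕜)) (y : Euc d) : sconv h g y = ∫ x, h x * g (y - x) := rfl

theorem iteratedFDeriv_sconv (h g : 𝓢(Euc d, 𝕜)) (n : ℕ) (y : Euc d) :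
    iteratedFDeriv ℝ n (sconv h g) y = ∫ x, h x • iteratedFDeriv ℝ n g (y - x) :=
  congr_fun (iteratedFDeriv_integral_smul_comp_sub h.integrable g n).1 y

theorem sconv_comm (h g : 𝓢(Euc d, 𝕜)) : sconv h g = sconv g h := by
  ext y
  rw [sconv_apply, sconv_apply,
    ← integral_sub_left_eq_self (fun x => h x * g (y - x)) volume y]
  simp only [sub_sub_cancel, mul_comm]

/-! ### Tempered distributions commute with integrals -/

open scoped BoundedContinuousFunction

variable (𝕜 d) in
/-- The Banach space of the bounded continuous `(N + 1)`-tuples of weighted derivatives. -/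
def WeightedJets (N : ℕ) : Type _ :=
  (n : Fin (N + 1)) → (Euc d →ᵇ (Euc d [×(n : ℕ)]→L[ℝ] 𝕜))

instance (N : ℕ) : NormedAddCommGroup (WeightedJets 𝕜 d N) :=
  inferInstanceAs (NormedAddCommGroup
    ((n : Fin (N + 1)) → (Euc d →ᵇ (Euc d [×(n : ℕ)]→L[ℝ] 𝕜))))

instance (N : ℕ) : NormedSpace 𝕜 (WeightedJets 𝕜 d N) :=
  inferInstanceAs (NormedSpace 𝕜
    ((n : Fin (N + 1)) → (Euc d →ᵇ (Euc d [×(n : ℕ)]→L[ℝ] 𝕜))))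

instance (N : ℕ) : NormedSpace ℝ (WeightedJets 𝕜 d N) :=
  inferInstanceAs (NormedSpace ℝ
    ((n : Fin (N + 1)) → (Euc d →ᵇ (Euc d [×(n : ℕ)]→L[ℝ] 𝕜))))

instance (N : ℕ) : IsScalarTower ℝ 𝕜 (WeightedJets 𝕜 d N) :=
  inferInstanceAs (IsScalarTower ℝ 𝕜
    ((n : Fin (N + 1)) → (Euc d →ᵇ (Euc d [×(n : ℕ)]→L[ℝ] 𝕜))))

instance (N : ℕ) : CompleteSpace (WeightedJets 𝕜 d N) :=
  inferInstanceAs (CompleteSpace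
    ((n : Fin (N + 1)) → (Euc d →ᵇ (Euc d [×(n : ℕ)]→L[ℝ] 𝕜))))

variable (𝕜 d) in
/-- The evaluation of the `n`-th component at a point. -/
def WeightedJets.eval (N : ℕ) (n : Fin (N + 1)) (y : Euc d) :
    WeightedJets 𝕜 d N →L[𝕜] (Euc d [×(n : ℕ)]→L[ℝ] 𝕜) :=
  (BoundedContinuousFunction.evalCLM 𝕜 y).comp
    (ContinuousLinearMap.proj (R := 𝕜)
      (φ := fun n : Fin (N + 1) => Euc d →ᵇ (Euc d [×(n : ℕ)]→L[ℝ] 𝕜)) n)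

/-- The weighted derivative `y ↦ (1 + |y|)^N D^n ψ(y)`. -/
def weightedDeriv (N n : ℕ) (ψ : 𝓢(Euc d, 𝕜)) : Euc d →ᵇ (Euc d [×n]→L[ℝ] 𝕜) :=
  BoundedContinuousFunction.ofNormedAddCommGroup
    (fun y => ((1 + ‖y‖) ^ N : ℝ) • iteratedFDeriv ℝ n ψ y)
    (by
      have : Continuous (iteratedFDeriv ℝ n ψ) :=
        (ψ.smooth ⊤).continuous_iteratedFDeriv (mod_cast le_top)
      fun_prop)
    (ψ.exists_one_add_norm_pow_mul_le N n).choose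
    (fun y => by
      rw [norm_smul, Real.norm_of_nonneg (by positivity)]
      exact (ψ.exists_one_add_norm_pow_mul_le N n).choose_spec.2 y)

theorem weightedDeriv_apply (N n : ℕ) (ψ : 𝓢(Euc d, 𝕜)) (y : Euc d) :
    weightedDeriv N n ψ y = ((1 + ‖y‖) ^ N : ℝ) • iteratedFDeriv ℝ n ψ y := rfl

theorem norm_weightedDeriv_apply (N n : ℕ) (ψ : 𝓢(Euc d, 𝕜)) (y : Euc d) :
    ‖weightedDeriv N n ψ y‖ = (1 + ‖y‖) ^ N * ‖iteratedFDeriv ℝ n ψ y‖ := by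
  rw [weightedDeriv_apply, norm_smul, Real.norm_of_nonneg (by positivity)]

theorem contDiffAt_schwartz (ψ : 𝓢(Euc d, 𝕜)) (n : ℕ) (y : Euc d) : ContDiffAt ℝ n ψ y :=
  ((ψ.smooth ⊤).of_le (mod_cast le_top)).contDiffAt

variable (𝕜 d) in
/-- A Schwartz function is mapped to its weighted derivatives of order at most `N`. -/
def weightedJet (N : ℕ) : 𝓢(Euc d, 𝕜) →ₗ[𝕜] WeightedJets 𝕜 d N where
  toFun ψ n := weightedDeriv N n ψ
  map_add' φ ψ := by
    funext n
    ext1 y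
    change _ = weightedDeriv N n φ y + weightedDeriv N n ψ y
    have h := iteratedFDeriv_add_apply (contDiffAt_schwartz φ n y) (contDiffAt_schwartz ψ n y)
    rw [weightedDeriv_apply, weightedDeriv_apply, weightedDeriv_apply]
    exact (congr_arg (((1 + ‖y‖) ^ N : ℝ) • ·) h).trans (smul_add (A := Euc d [×(n : ℕ)]→L[ℝ] 𝕜) _ _ _)
  map_smul' c ψ := by
    funext n
    ext1 y
    change _ = c • weightedDeriv N n ψ y
    rw [weightedDeriv_apply, weightedDeriv_apply, smul_comm,
      ← iteratedFDeriv_const_smul_apply (contDiffAt_schwartz ψ n y)]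
    rfl

theorem WeightedJets.norm_apply_le {N : ℕ} (b : WeightedJets 𝕜 d N) (n : Fin (N + 1)) :
    ‖b n‖ ≤ ‖b‖ :=
  norm_le_pi_norm (G := fun n : Fin (N + 1) => Euc d →ᵇ (Euc d [×(n : ℕ)]→L[ℝ] 𝕜)) b n

theorem norm_weightedJet_le {N : ℕ} {ψ : 𝓢(Euc d, 𝕜)} {M : ℝ} (hM : 0 ≤ M)
    (h : ∀ n ≤ N, ∀ y, (1 + ‖y‖) ^ N * ‖iteratedFDeriv ℝ n ψ y‖ ≤ M) :
    ‖weightedJet 𝕜 d N ψ‖ ≤ M := by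
  refine (pi_norm_le_iff_of_nonneg
    (G := fun n : Fin (N + 1) => Euc d →ᵇ (Euc d [×(n : ℕ)]→L[ℝ] 𝕜)) hM).2 fun n =>
    (BoundedContinuousFunction.norm_le hM).2 fun y => ?_
  change ‖weightedDeriv N n ψ y‖ ≤ M
  rw [norm_weightedDeriv_apply]
  exact h n (Nat.lt_succ_iff.1 n.2) y

/-- A linear functional which is dominated by a linear map to a normed space factors through it. -/
theorem exists_eq_comp_of_norm_le {V B : Type*} [AddCommGroup V] [Module 𝕜 V]
    [NormedAddCommGroup B] [NormedSpace 𝕜 B] (J : V →ₗ[𝕜] B) (T : V →ₗ[𝕜] 𝕜) (C : ℝ)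
    (hT : ∀ ψ, ‖T ψ‖ ≤ C * ‖J ψ‖) : ∃ S : B →L[𝕜] 𝕜, ∀ ψ, T ψ = S (J ψ) := by
  -- A linear section of `J` over its range. The bound makes `T` vanish on the kernel of `J`, so `T
  -- ∘ g` is the functional induced on the range; Hahn–Banach extends it.
  obtain ⟨g, hg⟩ := J.rangeRestrict.exists_rightInverse_of_surjective J.range_rangeRestrict
  have hJg : ∀ b : LinearMap.range J, J (g b) = b := fun b =>
    congr_arg Subtype.val (LinearMap.congr_fun hg b)
  let f₀ : LinearMap.range J →L[𝕜] 𝕜 := LinearMap.mkContinuous (T ∘ₗ g) C fun b => by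
    have := hT (g b)
    rw [hJg b] at this
    exact this
  obtain ⟨S, hS, -⟩ := exists_extension_norm_eq (LinearMap.range J) f₀
  refine ⟨S, fun ψ => ?_⟩
  have h1 := hS ⟨J ψ, LinearMap.mem_range_self J ψ⟩
  rw [h1]
  change T ψ = T (g ⟨J ψ, LinearMap.mem_range_self J ψ⟩)
  -- `ψ` and the section value at `J ψ` have the same image under `J`, so the domination forces `T`
  -- to agree on them.
  rw [← sub_eq_zero, ← map_sub, ← norm_le_zero_iff]
  refine (hT _).trans ?_
  rw [map_sub, hJg, sub_self, norm_zero, mul_zero]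

/-- A tempered distribution is the restriction of a continuous linear functional on a space of
weighted derivatives. -/
theorem TDist.exists_eq_comp_weightedJet (T : TDist 𝕜 d) :
    ∃ (N : ℕ) (S : WeightedJets 𝕜 d N →L[𝕜] 𝕜), ∀ ψ, T ψ = S (weightedJet 𝕜 d N ψ) := by
  obtain ⟨C, N, hC, h⟩ := T.exists_bound
  refine ⟨N, exists_eq_comp_of_norm_le (weightedJet 𝕜 d N) T.toLinearMap C fun ψ =>
    h ψ _ (norm_nonneg _) fun n hn y => ?_⟩
  rw [← norm_weightedDeriv_apply]
  exact ((weightedDeriv N n ψ).norm_coe_le_norm y).trans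
    ((weightedJet 𝕜 d N ψ).norm_apply_le ⟨n, Nat.lt_succ_of_le hn⟩)

theorem iteratedFDeriv_compSubConst (g : 𝓢(Euc d, 𝕜)) (n : ℕ) (x y : Euc d) :
    iteratedFDeriv ℝ n (SchwartzMap.compSubConstCLM 𝕜 x g) y = iteratedFDeriv ℝ n g (y - x) :=
  iteratedFDeriv_comp_sub n x y

/-- Polynomial growth in the translation parameter; against the Schwartz weight `h` it makes the
jet-valued integrand of `TDist.apply_sconv` integrable. -/
theorem exists_norm_weightedJet_compSubConst_le (N : ℕ) (g : 𝓢(Euc d, 𝕜)) :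
    ∃ C, ∀ x, ‖weightedJet 𝕜 d N (SchwartzMap.compSubConstCLM 𝕜 x g)‖ ≤ C * (1 + ‖x‖) ^ N := by
  obtain ⟨M, hM, h⟩ := g.exists_uniform_one_add_norm_pow_mul_le N
  refine ⟨M, fun x => norm_weightedJet_le (by positivity) fun n hn y => ?_⟩
  rw [iteratedFDeriv_compSubConst]
  calc _ ≤ ((1 + ‖x‖) ^ N * (1 + ‖y - x‖) ^ N) * ‖iteratedFDeriv ℝ n g (y - x)‖ := by
        gcongr
        exact one_add_norm_pow_le_mul y x N
    _ = ((1 + ‖y - x‖) ^ N * ‖iteratedFDeriv ℝ n g (y - x)‖) * (1 + ‖x‖) ^ N := by ring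
    _ ≤ _ := by
      gcongr
      exact h n hn _

theorem one_add_norm_pow_mul_norm_iteratedFDeriv_sub_le {F : Type*} [NormedAddCommGroup F]
    [NormedSpace ℝ F] (g : 𝓢(Euc d, F)) (N : ℕ) : ∃ C, 0 ≤ C ∧ ∀ n ≤ N, ∀ z v,
      (1 + ‖z‖) ^ N * ‖iteratedFDeriv ℝ n g (z + v) - iteratedFDeriv ℝ n g z‖ ≤
        C * (1 + ‖v‖) ^ N * ‖v‖ := by
  -- One order more than `N`, since the mean value inequality for the `n`-th derivative uses the
  -- derivative of order `n + 1`.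
  obtain ⟨M, hM, h⟩ := g.exists_uniform_one_add_norm_pow_mul_le (N + 1)
  refine ⟨M, hM, fun n hn z v => ?_⟩
  refine one_add_norm_pow_mul_norm_sub_le
    ((g.smooth ⊤).differentiable_iteratedFDeriv (mod_cast WithTop.coe_lt_top _)) (fun w => ?_) z v
  rw [norm_fderiv_iteratedFDeriv]
  refine le_trans ?_ (h (n + 1) (by omega) w)
  gcongr
  · linarith [norm_nonneg w]
  · omega

/-- Continuity of translation in the jet norm supplies the strong measurability required for the
Bochner integral. -/
theorem continuous_weightedJet_compSubConst (N : ℕ) (g : 𝓢(Euc d, 𝕜)) :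
    Continuous fun x => weightedJet 𝕜 d N (SchwartzMap.compSubConstCLM 𝕜 x g) := by
  obtain ⟨C, hC0, hC⟩ := one_add_norm_pow_mul_norm_iteratedFDeriv_sub_le g N
  rw [continuous_iff_continuousAt]
  intro x
  refine tendsto_iff_norm_sub_tendsto_zero.2 ?_
  have hlim : Tendsto (fun w : Euc d => (1 + ‖x‖) ^ N * (C * (1 + ‖x - w‖) ^ N * ‖x - w‖)) (𝓝 x)
      (𝓝 0) := by
    have : Continuous fun w : Euc d => (1 + ‖x‖) ^ N * (C * (1 + ‖x - w‖) ^ N * ‖x - w‖) := by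
      fun_prop
    simpa using this.tendsto x
  refine squeeze_zero (fun _ => norm_nonneg _) (fun w => ?_) hlim
  rw [← map_sub]
  refine norm_weightedJet_le (by positivity) fun n hn y => ?_
  have h1 := hC n hn (y - x) (x - w)
  have h2 : iteratedFDeriv ℝ n (SchwartzMap.compSubConstCLM 𝕜 w g -
      SchwartzMap.compSubConstCLM 𝕜 x g : 𝓢(Euc d, 𝕜)) y =
      iteratedFDeriv ℝ n g (y - w) - iteratedFDeriv ℝ n g (y - x) := by
    rw [← iteratedFDeriv_compSubConst, ← iteratedFDeriv_compSubConst]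
    exact iteratedFDeriv_sub_apply (contDiffAt_schwartz _ n y) (contDiffAt_schwartz _ n y)
  rw [sub_add_sub_cancel] at h1
  rw [h2]
  calc _ ≤ ((1 + ‖x‖) ^ N * (1 + ‖y - x‖) ^ N) *
        ‖iteratedFDeriv ℝ n g (y - w) - iteratedFDeriv ℝ n g (y - x)‖ := by
        gcongr
        exact one_add_norm_pow_le_mul y x N
    _ ≤ (1 + ‖x‖) ^ N * (C * (1 + ‖x - w‖) ^ N * ‖x - w‖) := by
        rw [mul_assoc]
        gcongr

/-- The convolution is a superposition of translates of `g`. In the jet space it is a Bochner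
integral, through which the continuous functional `S` passes. -/
theorem TDist.apply_sconv (T : TDist 𝕜 d) (h g : 𝓢(Euc d, 𝕜)) :
    T (sconv h g) = ∫ x, h x * T (SchwartzMap.compSubConstCLM 𝕜 x g) := by
  obtain ⟨N, S, hS⟩ := T.exists_eq_comp_weightedJet
  let G : Euc d → WeightedJets 𝕜 d N := fun x =>
    h x • weightedJet 𝕜 d N (SchwartzMap.compSubConstCLM 𝕜 x g)
  have hG : Integrable G := by
    obtain ⟨C, hC⟩ := exists_norm_weightedJet_compSubConst_le N g
    refine Integrable.mono' ((h.integrable_one_add_norm_pow_mul N).mul_const C)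
      (h.continuous.smul (continuous_weightedJet_compSubConst N g)).aestronglyMeasurable
      (Eventually.of_forall fun x => ?_)
    rw [norm_smul]
    refine (mul_le_mul_of_nonneg_left (hC x) (norm_nonneg _)).trans (le_of_eq (by ring))
  -- The evaluations at points are continuous linear maps that separate jets, so the identity
  -- reduces to differentiation under the integral sign.
  have hJ : weightedJet 𝕜 d N (sconv h g) = ∫ x, G x := by
    funext n
    ext1 y
    change weightedDeriv N n (sconv h g) y = WeightedJets.eval 𝕜 d N n y (∫ x, G x)
    rw [← (WeightedJets.eval 𝕜 d N n y).integral_comp_comm hG]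
    rw [weightedDeriv_apply, iteratedFDeriv_sconv, ← integral_smul]
    refine integral_congr_ae (Eventually.of_forall fun x => ?_)
    change _ = h x • weightedDeriv N n (SchwartzMap.compSubConstCLM 𝕜 x g) y
    rw [weightedDeriv_apply, iteratedFDeriv_compSubConst]
    exact smul_comm _ _ _
  rw [hS, hJ, ← S.integral_comp_comm hG]
  refine integral_congr_ae (Eventually.of_forall fun x => ?_)
  simp only [G, map_smul, smul_eq_mul, hS]

/-! ### Estimates for `ν_{φ,l}` as `ε → 0` -/

/-- Needed for uniqueness of limits as `ε → 0`, on which both injectivity proofs rely. -/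
instance : NeBot toZero := by
  refine comap_neBot fun s hs => ?_
  obtain ⟨a, ha, hs⟩ := mem_nhdsGT_iff_exists_Ioo_subset.1 hs
  have ha : 0 < a := ha
  exact ⟨⟨min (a / 2) 1, by positivity, min_le_right _ _⟩,
    hs ⟨by positivity, (min_le_left _ _).trans_lt (by linarith)⟩⟩

theorem tendsto_coe_toZero : Tendsto (fun ε : Par => (ε : ℝ)) toZero (𝓝 0) :=
  tendsto_nhdsWithin_iff.1 tendsto_comap |>.1

/-- One spare power of `ε` turns a uniform bound into a little-o. -/
theorem isLittleO_zpow_of_le {f : Par → ℝ} {C : ℝ} {k : ℤ} (h0 : ∀ ε, 0 ≤ f ε)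
    (h : ∀ ε, f ε ≤ C * (ε : ℝ) ^ (k + 1)) : f =o[toZero] fun ε : Par => (ε : ℝ) ^ k := by
  have h1 : f =O[toZero] fun ε : Par => (ε : ℝ) ^ k * (ε : ℝ) := by
    refine IsBigO.of_bound C (Eventually.of_forall fun ε => ?_)
    have := ε.2.1
    rw [Real.norm_of_nonneg (h0 ε), Real.norm_of_nonneg (by positivity), ← zpow_add_one₀ this.ne']
    exact h ε
  have h2 : (fun ε : Par => (ε : ℝ)) =o[toZero] fun _ => (1 : ℝ) :=
    (isLittleO_one_iff ℝ).2 tendsto_coe_toZero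
  exact h1.trans_isLittleO (((isBigO_refl (fun ε : Par => (ε : ℝ) ^ k) _).mul_isLittleO h2).congr_right
    fun ε => mul_one _)

/-- The Schwartz function `φ` absorbs polynomial growth of any degree, and only finitely many `α`
enter, so the exponent may depend on `α`. -/
theorem exists_nu_le {f : Par → OM 𝕜 d} {r : Par → ℝ} (hr : ∀ ε, 0 ≤ r ε) (φ : 𝓢(Euc d, 𝕜)) (l : ℕ)
    (h : ∀ α : Fin d → ℕ, ∑ i, α i ≤ l → ∃ (C : ℝ) (K : ℕ), 0 ≤ C ∧
      ∀ ε x, ‖(OM.deriv α (f ε) : Euc d → 𝕜) x‖ ≤ C * r ε * (1 + ‖x‖) ^ K) :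
    ∃ C, ∀ ε, nu φ l (f ε) ≤ C * r ε := by
  have h1 : ∀ α : MIdx d l, ∃ C : ℝ, ∀ ε x, ‖φ x * (OM.deriv α.1 (f ε) : Euc d → 𝕜) x‖ ≤ C * r ε := by
    intro α
    obtain ⟨C, K, hC0, hC⟩ := h α.1 α.2
    obtain ⟨B, hB0, hB⟩ := φ.exists_one_add_norm_pow_mul_le K 0
    refine ⟨C * B, fun ε x => ?_⟩
    have hBx := hB x
    rw [norm_iteratedFDeriv_zero] at hBx
    rw [norm_mul]
    calc _ ≤ ‖φ x‖ * (C * r ε * (1 + ‖x‖) ^ K) := by gcongr; exact hC ε x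
      _ = C * r ε * ((1 + ‖x‖) ^ K * ‖φ x‖) := by ring
      _ ≤ C * r ε * B := by
        have := hr ε
        gcongr
      _ = _ := by ring
  choose C hC using h1
  obtain ⟨B, hB⟩ := (Set.finite_range C).bddAbove
  refine ⟨B, fun ε => nu_le _ _ _ _ fun x α hα => (hC ⟨α, hα⟩ ε x).trans ?_⟩
  exact mul_le_mul_of_nonneg_right (hB ⟨_, rfl⟩) (hr ε)

/-! ### The scaled mollifier -/

theorem norm_iteratedFDeriv_scaled (ρ : 𝓢(Euc d, 𝕜)) (ε : Par) (n : ℕ) (z : Euc d) :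
    ‖iteratedFDeriv ℝ n (scaled ρ ε) z‖ =
      ((ε : ℝ) ^ (d + n))⁻¹ * ‖iteratedFDeriv ℝ n ρ ((ε : ℝ)⁻¹ • z)‖ := by
  have hε := ε.2.1
  have h1 : (scaled ρ ε : Euc d → 𝕜) = fun x => (((ε : ℝ) ^ d)⁻¹ : ℝ) • ρ ((ε : ℝ)⁻¹ • x) := rfl
  have h2 : ContDiff ℝ n ρ := (ρ.smooth ⊤).of_le (mod_cast le_top)
  have h3 : ContDiff ℝ n fun x => ρ ((ε : ℝ)⁻¹ • x) :=
    h2.comp (contDiff_id.const_smul ((ε : ℝ)⁻¹))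
  rw [h1, iteratedFDeriv_const_smul_apply' h3.contDiffAt,
    iteratedFDeriv_comp_const_smul _ h2, norm_smul, norm_smul, Real.norm_of_nonneg (by positivity),
    Real.norm_of_nonneg (by positivity), ← mul_assoc, pow_add, mul_inv, inv_pow]

theorem norm_le_norm_inv_smul (ε : Par) (z : Euc d) : ‖z‖ ≤ ‖(ε : ℝ)⁻¹ • z‖ := by
  rw [norm_smul, norm_inv, Real.norm_of_nonneg ε.2.1.le]
  exact le_mul_of_one_le_left (norm_nonneg z) ((one_le_inv₀ ε.2.1).2 ε.2.2)

/-- The normalisation of the mollifier costs `ε ^ (-d)` and each derivative another `ε⁻¹`; dilating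
by `ε⁻¹ ≥ 1` only increases the weight. -/
theorem TDist.conv_scaled_bound (T : TDist 𝕜 d) (ρ : 𝓢(Euc d, 𝕜)) :
    ∃ (C : ℝ) (N : ℕ), 0 ≤ C ∧ ∀ (ε : Par) x,
      ‖T.conv (scaled ρ ε) x‖ ≤ C * (ε : ℝ) ^ (-(N : ℤ)) * (1 + ‖x‖) ^ N := by
  obtain ⟨C, N, hC, h⟩ := T.exists_conv_bound
  obtain ⟨M, hM, hρ⟩ := ρ.exists_uniform_one_add_norm_pow_mul_le N
  -- A single exponent serves for both the power of `ε` and the growth in `x`; the latter only needs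
  -- `N`.
  refine ⟨C * M, d + N, by positivity, fun ε x => ?_⟩
  have hε := ε.2.1
  refine (h (scaled ρ ε) (M * ((ε : ℝ) ^ (d + N))⁻¹) (by positivity) (fun n hn y => ?_) x).trans ?_
  · rw [norm_iteratedFDeriv_scaled]
    calc (1 + ‖y‖) ^ N * (((ε : ℝ) ^ (d + n))⁻¹ * ‖iteratedFDeriv ℝ n ρ ((ε : ℝ)⁻¹ • y)‖)
        ≤ (1 + ‖(ε : ℝ)⁻¹ • y‖) ^ N *
            (((ε : ℝ) ^ (d + N))⁻¹ * ‖iteratedFDeriv ℝ n ρ ((ε : ℝ)⁻¹ • y)‖) := by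
          have h1 := norm_le_norm_inv_smul ε y
          have h2 : (ε : ℝ) ^ (d + N) ≤ (ε : ℝ) ^ (d + n) :=
            pow_le_pow_of_le_one hε.le ε.2.2 (by omega)
          gcongr
      _ = ((1 + ‖(ε : ℝ)⁻¹ • y‖) ^ N * ‖iteratedFDeriv ℝ n ρ ((ε : ℝ)⁻¹ • y)‖) *
            ((ε : ℝ) ^ (d + N))⁻¹ := by ring
      _ ≤ _ := by
          gcongr
          exact hρ n hn _
  · rw [zpow_neg, zpow_natCast, ← mul_assoc]
    gcongr
    · linarith [norm_nonneg x]
    · omega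

theorem TDist.conv_scaled_mem_moderate (T : TDist 𝕜 d) (ρ : 𝓢(Euc d, 𝕜)) :
    (fun ε : Par => T.convOM (scaled ρ ε)) ∈ Moderate 𝕜 d := by
  intro φ l
  choose C N hC h using fun α : MIdx d l => (TDist.deriv α.1 T).conv_scaled_bound ρ
  obtain ⟨m, hm⟩ := (Set.finite_range N).bddAbove
  obtain ⟨B, hB⟩ := exists_nu_le (f := fun ε : Par => T.convOM (scaled ρ ε))
    (r := fun ε : Par => (ε : ℝ) ^ (-(m : ℤ))) (fun ε => zpow_nonneg ε.2.1.le _) φ l (by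
      intro α hα
      refine ⟨C ⟨α, hα⟩, N ⟨α, hα⟩, hC _, fun ε x => ?_⟩
      rw [TDist.deriv_convOM]
      refine (h ⟨α, hα⟩ ε x).trans ?_
      have h1 : N ⟨α, hα⟩ ≤ m := hm ⟨_, rfl⟩
      have := hC ⟨α, hα⟩
      have := zpow_le_zpow_right_of_le_one₀ ε.2.1 ε.2.2 (neg_le_neg (Int.ofNat_le.2 h1))
      gcongr)
  exact ⟨m + 1, isLittleO_zpow_of_le (C := B) (fun ε => nu_nonneg _ _ _) fun ε => by
    have : (-((m + 1 : ℕ) : ℤ) + 1) = -(m : ℤ) := by push_cast; ring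
    rw [this]
    exact hB ε⟩

theorem integral_scaled {F : Type*} [NormedAddCommGroup F] [NormedSpace ℝ F] (f : Euc d → F)
    (ε : Par) : ∫ x, (((ε : ℝ) ^ d)⁻¹ : ℝ) • f ((ε : ℝ)⁻¹ • x) = ∫ x, f x := by
  have hε := ε.2.1
  rw [integral_smul, Measure.integral_comp_smul, smul_smul, finrank_euclideanSpace_fin, inv_pow,
    inv_inv, abs_of_pos (by positivity), inv_mul_cancel₀ (by positivity), one_smul]

/-! ### Approximation of the identity -/

/-- The reflected mollifier `x ↦ ρ_ε(-x)`. -/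
def reflScaled (ρ : 𝓢(Euc d, 𝕜)) (ε : Par) : 𝓢(Euc d, 𝕜) := reflTranslate (scaled ρ ε) 0

theorem reflScaled_apply (ρ : 𝓢(Euc d, 𝕜)) (ε : Par) (x : Euc d) :
    reflScaled ρ ε x = (((ε : ℝ) ^ d)⁻¹ : ℝ) • reflTranslate ρ 0 ((ε : ℝ)⁻¹ • x) := by
  rw [reflScaled, reflTranslate_apply, scaled_apply, reflTranslate_apply]
  simp

theorem integral_reflScaled (ρ : 𝓢(Euc d, 𝕜)) (ε : Par) : ∫ x, reflScaled ρ ε x = ∫ x, ρ x := by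
  simp only [reflScaled_apply]
  rw [integral_scaled]
  simp only [reflTranslate_apply]
  exact integral_sub_left_eq_self (fun x => ρ x) volume 0

/-- As the mollifier has integral 1, the difference is an average of increments of `φ`. These are
`O(‖x‖)` in the weighted norms, and `‖x‖ = ε ‖x / ε‖` yields the factor `ε`. -/
theorem exists_sconv_reflScaled_sub_le (ρ : 𝓢(Euc d, 𝕜)) (hρ : ∫ x, ρ x = 1) (φ : 𝓢(Euc d, 𝕜))
    (N : ℕ) : ∃ C, 0 ≤ C ∧ ∀ (ε : Par), ∀ n ≤ N, ∀ y,
      (1 + ‖y‖) ^ N * ‖iteratedFDeriv ℝ n (sconv (reflScaled ρ ε) φ - φ : 𝓢(Euc d, 𝕜)) y‖ ≤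
        C * ε := by
  obtain ⟨C, hC0, hC⟩ := one_add_norm_pow_mul_norm_iteratedFDeriv_sub_le φ N
  let σ := reflTranslate ρ 0
  -- The increment bound contributes `(1 + ‖x‖) ^ N` and one further factor `‖x‖`.
  have hσ := σ.integrable_one_add_norm_pow_mul (N + 1)
  refine ⟨C * ∫ x, (1 + ‖x‖) ^ (N + 1) * ‖σ x‖, mul_nonneg hC0 (integral_nonneg fun x => by positivity),
    fun ε n hn y => ?_⟩
  have hε := ε.2.1
  obtain ⟨B, hB⟩ := φ.exists_norm_iteratedFDeriv_le n
  have hcont : Continuous (iteratedFDeriv ℝ n φ) :=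
    (φ.smooth ⊤).continuous_iteratedFDeriv (mod_cast le_top)
  have e1 : iteratedFDeriv ℝ n (sconv (reflScaled ρ ε) φ - φ : 𝓢(Euc d, 𝕜)) y =
      ∫ x, reflScaled ρ ε x • (iteratedFDeriv ℝ n φ (y - x) - iteratedFDeriv ℝ n φ y) := by
    have h1 : iteratedFDeriv ℝ n (sconv (reflScaled ρ ε) φ - φ : 𝓢(Euc d, 𝕜)) y =
        iteratedFDeriv ℝ n (sconv (reflScaled ρ ε) φ) y - iteratedFDeriv ℝ n φ y :=
      iteratedFDeriv_sub_apply (contDiffAt_schwartz _ n y) (contDiffAt_schwartz _ n y)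
    simp only [smul_sub]
    rw [h1, integral_sub (integrable_smul_comp_sub (reflScaled ρ ε).integrable hcont hB y)
      ((reflScaled ρ ε).integrable.smul_const _), integral_smul_const, integral_reflScaled, hρ,
      one_smul, iteratedFDeriv_sconv]
  have h3 : Integrable fun x : Euc d => (((ε : ℝ) ^ d)⁻¹ : ℝ) •
      ((1 + ‖(ε : ℝ)⁻¹ • x‖) ^ (N + 1) * ‖σ ((ε : ℝ)⁻¹ • x)‖) :=
    ((integrable_comp_smul_iff volume (fun x => (1 + ‖x‖) ^ (N + 1) * ‖σ x‖)
      (inv_ne_zero hε.ne')).2 hσ).smul (((ε : ℝ) ^ d)⁻¹)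
  calc (1 + ‖y‖) ^ N * ‖iteratedFDeriv ℝ n (sconv (reflScaled ρ ε) φ - φ : 𝓢(Euc d, 𝕜)) y‖
      = ‖∫ x, ((1 + ‖y‖) ^ N : ℝ) • reflScaled ρ ε x •
          (iteratedFDeriv ℝ n φ (y - x) - iteratedFDeriv ℝ n φ y)‖ := by
        rw [e1, integral_smul, norm_smul, Real.norm_of_nonneg (by positivity)]
    _ ≤ ∫ x, (C * ε) * ((((ε : ℝ) ^ d)⁻¹ : ℝ) •
          ((1 + ‖(ε : ℝ)⁻¹ • x‖) ^ (N + 1) * ‖σ ((ε : ℝ)⁻¹ • x)‖)) := by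
        refine norm_integral_le_of_norm_le (h3.const_mul _) (Eventually.of_forall fun x => ?_)
        have h4 := hC n hn y (-x)
        rw [← sub_eq_add_neg, norm_neg] at h4
        have h5 : ‖x‖ = ε * ‖(ε : ℝ)⁻¹ • x‖ := by
          rw [norm_smul, norm_inv, Real.norm_of_nonneg hε.le, mul_inv_cancel_left₀ hε.ne']
        have h6 : (1 + ‖x‖) ^ N * ‖x‖ ≤ ε * (1 + ‖(ε : ℝ)⁻¹ • x‖) ^ (N + 1) := by
          calc (1 + ‖x‖) ^ N * ‖x‖ = (1 + ‖x‖) ^ N * (ε * ‖(ε : ℝ)⁻¹ • x‖) := by rw [← h5]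
            _ ≤ (1 + ‖(ε : ℝ)⁻¹ • x‖) ^ N * (ε * (1 + ‖(ε : ℝ)⁻¹ • x‖)) := by
                have := norm_le_norm_inv_smul ε x
                gcongr
                linarith
            _ = _ := by ring
        rw [norm_smul, norm_smul, Real.norm_of_nonneg (by positivity), reflScaled_apply, norm_smul,
          Real.norm_of_nonneg (by positivity), smul_eq_mul]
        calc (1 + ‖y‖) ^ N * ((((ε : ℝ) ^ d)⁻¹ * ‖σ ((ε : ℝ)⁻¹ • x)‖) *
              ‖iteratedFDeriv ℝ n φ (y - x) - iteratedFDeriv ℝ n φ y‖)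
            = (((ε : ℝ) ^ d)⁻¹ * ‖σ ((ε : ℝ)⁻¹ • x)‖) * ((1 + ‖y‖) ^ N *
              ‖iteratedFDeriv ℝ n φ (y - x) - iteratedFDeriv ℝ n φ y‖) := by ring
          _ ≤ (((ε : ℝ) ^ d)⁻¹ * ‖σ ((ε : ℝ)⁻¹ • x)‖) *
              (C * (ε * (1 + ‖(ε : ℝ)⁻¹ • x‖) ^ (N + 1))) := by
              refine mul_le_mul_of_nonneg_left (h4.trans ?_) (by positivity)
              rw [mul_assoc]
              gcongr
          _ = _ := by ring
    _ = _ := by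
        rw [integral_const_mul,
          integral_scaled (fun x => (1 + ‖x‖) ^ (N + 1) * ‖σ x‖) ε]
        ring

theorem TDist.tendsto_apply_sconv_reflScaled (T : TDist 𝕜 d) (ρ : 𝓢(Euc d, 𝕜)) (hρ : ∫ x, ρ x = 1)
    (φ : 𝓢(Euc d, 𝕜)) :
    Tendsto (fun ε : Par => T (sconv (reflScaled ρ ε) φ)) toZero (𝓝 (T φ)) := by
  obtain ⟨C, N, hC, h⟩ := T.exists_bound
  obtain ⟨B, hB0, hB⟩ := exists_sconv_reflScaled_sub_le ρ hρ φ N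
  refine tendsto_iff_norm_sub_tendsto_zero.2 (squeeze_zero (fun _ => norm_nonneg _)
    (g := fun ε : Par => C * (B * ε)) (fun ε => ?_) ?_)
  · have := ε.2.1
    rw [← map_sub]
    exact h _ _ (by positivity) (hB ε)
  · simpa using (tendsto_coe_toZero.const_mul B).const_mul C

/-- `ρ_ε(x - ·)` is the translate by `x` of the reflected mollifier, so this is `TDist.apply_sconv`
with the roles of the factors exchanged. -/
theorem TDist.integral_mul_conv_scaled (T : TDist 𝕜 d) (ρ φ : 𝓢(Euc d, 𝕜)) (ε : Par) :
    ∫ x, φ x * T.conv (scaled ρ ε) x = T (sconv (reflScaled ρ ε) φ) := by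
  rw [sconv_comm, TDist.apply_sconv]
  refine integral_congr_ae (Eventually.of_forall fun x => ?_)
  simp only [TDist.conv]
  congr 2
  ext y
  simp [reflScaled, reflTranslate_apply]

theorem TDist.eq_zero_of_negligible (T : TDist 𝕜 d) (ρ : 𝓢(Euc d, 𝕜)) (hρ : ∫ x, ρ x = 1)
    (h : ∀ φ : 𝓢(Euc d, 𝕜), Tendsto (fun ε : Par => nu φ 0 (T.convOM (scaled ρ ε))) toZero (𝓝 0)) :
    T = 0 := by
  refine ContinuousLinearMap.ext fun φ => ?_
  -- From `|φ| ≤ |ψ|²`, one factor `ψ` makes the integral finite and the other turns `T * ρ_ε` into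
  -- the seminorm `ν_{ψ,0}`.
  obtain ⟨ψ, hψ⟩ := exists_sq_majorant φ
  refine tendsto_nhds_unique (T.tendsto_apply_sconv_reflScaled ρ hρ φ) ?_
  simp only [← T.integral_mul_conv_scaled]
  refine squeeze_zero_norm (a := fun ε : Par => (∫ x, ‖ψ x‖) * nu ψ 0 (T.convOM (scaled ρ ε)))
    (fun ε => ?_) (by simpa using (h ψ).const_mul (∫ x, ‖ψ x‖))
  rw [← integral_mul_const]
  refine norm_integral_le_of_norm_le (ψ.integrable.norm.mul_const _)
    (Eventually.of_forall fun x => ?_)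
  have h1 := le_nu ψ 0 (T.convOM (scaled ρ ε)) x 0 (by simp)
  rw [OM.deriv_zero, norm_mul] at h1
  rw [norm_mul]
  calc ‖φ x‖ * ‖T.conv (scaled ρ ε) x‖ ≤ ‖ψ x‖ ^ 2 * ‖T.conv (scaled ρ ε) x‖ := by
        gcongr
        exact hψ x
    _ = ‖ψ x‖ * (‖ψ x‖ * ‖T.conv (scaled ρ ε) x‖) := by ring
    _ ≤ _ := mul_le_mul_of_nonneg_left h1 (norm_nonneg _)

/-- A bump function equal to 1 at `x` makes `ν_{φ,0}(u)` an upper bound for `|u(x)|`. -/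
theorem OM.eq_zero_of_nu_eq_zero (u : OM 𝕜 d) (h : ∀ φ : 𝓢(Euc d, 𝕜), nu φ 0 u = 0) : u = 0 := by
  ext x
  let χ : ContDiffBump (0 : Euc d) := ⟨‖x‖ + 1, ‖x‖ + 2, by positivity, by linarith⟩
  let φ : 𝓢(Euc d, ℝ) := χ.hasCompactSupport.toSchwartzMap χ.contDiff
  have h1 := le_nu (φ.postcompCLM (𝕜 := ℝ) (RCLike.ofRealCLM : ℝ →L[ℝ] 𝕜)) 0 u x 0 (by simp)
  have h2 : φ x = 1 := χ.one_of_mem_closedBall (by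
    rw [mem_closedBall_zero_iff]
    change ‖x‖ ≤ ‖x‖ + 1
    linarith)
  rw [h, OM.deriv_zero, SchwartzMap.postcompCLM_apply, h2] at h1
  simpa using h1

/-! ### Regular distributions and vanishing moments -/

theorem OM.exists_norm_le (u : OM 𝕜 d) :
    ∃ (C : ℝ) (K : ℕ), 0 ≤ C ∧ ∀ x, ‖(u : Euc d → 𝕜) x‖ ≤ C * (1 + ‖x‖) ^ K := by
  obtain ⟨K, C, h⟩ := u.2.2 0
  have h' : ∀ x, ‖(u : Euc d → 𝕜) x‖ ≤ C * (1 + ‖x‖) ^ K := fun x => by simpa using h x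
  exact ⟨C, K, by simpa using (norm_nonneg _).trans (h' 0), h'⟩

theorem OM.integrable_mul (φ : 𝓢(Euc d, 𝕜)) (u : OM 𝕜 d) :
    Integrable fun x => φ x * (u : Euc d → 𝕜) x :=
  (SchwartzMap.bilinLeftCLM (ContinuousLinearMap.mul 𝕜 𝕜) u.2 φ).integrable

/-- Integration by parts, with no boundary term because all the products with `φ` are integrable. -/
theorem OM.pd_toTDist (u : OM 𝕜 d) (i : Fin d) :
    TDist.pd 𝕜 i (OM.toTDist u) = OM.toTDist (OM.pd 𝕜 i u) := by
  refine ContinuousLinearMap.ext fun φ => ?_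
  change TDist.pd 𝕜 i (OM.toTDist u) φ = OM.toTDist (OM.pd 𝕜 i u) φ
  rw [TDist.pd_apply, OM.toTDist_apply, OM.toTDist_apply]
  have h1 := OM.integrable_mul (∂_{(stdVec i : Euc d)} φ) u
  simp only [SchwartzMap.lineDerivOp_apply_eq_fderiv] at h1 ⊢
  exact (integral_mul_fderiv_eq_neg_fderiv_mul_of_integrable h1
    (OM.integrable_mul φ (OM.pd 𝕜 i u)) (OM.integrable_mul φ u)
    (fun x _ => φ.differentiableAt) (fun x _ => OM.differentiable u x)).symm

theorem OM.deriv_toTDist (u : OM 𝕜 d) (α : Fin d → ℕ) :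
    TDist.deriv α (OM.toTDist u) = OM.toTDist (OM.deriv α u) := by
  have h : ∀ (i : Fin d) (u : OM 𝕜 d),
      OM.toTDist ((OM.pd 𝕜 i : OM 𝕜 d →ₗ[𝕜] OM 𝕜 d) u) = TDist.pd 𝕜 i (OM.toTDist u) :=
    fun i u => (OM.pd_toTDist u i).symm
  have h2 := multiDeriv_intertwine _ _ _ h α u
  rw [TDist.deriv, OM.deriv, ← h2]

/-- The average `∫ η(z) u(x - t z) dz`. -/
def dilAvg (η : 𝓢(Euc d, 𝕜)) (u : OM 𝕜 d) (x : Euc d) (t : ℝ) : 𝕜 :=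
  ∫ z, η z * (u : Euc d → 𝕜) (x - t • z)

/-- The substitution `y = x - ε z` moves the parameter from the kernel to `u`, so that it can be
differentiated and even set to 0. -/
theorem conv_scaled_toTDist (ρ : 𝓢(Euc d, 𝕜)) (u : OM 𝕜 d) (ε : Par) (x : Euc d) :
    (OM.toTDist u).conv (scaled ρ ε) x = dilAvg ρ u x ε := by
  have hε := ε.2.1
  rw [TDist.conv, OM.toTDist_apply]
  simp only [reflTranslate_apply]
  rw [← integral_sub_left_eq_self (fun y => scaled ρ ε (x - y) * (u : Euc d → 𝕜) y) volume x,
    dilAvg, ← integral_scaled (fun z => ρ z * (u : Euc d → 𝕜) (x - (ε : ℝ) • z)) ε]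
  refine integral_congr_ae (Eventually.of_forall fun y => ?_)
  simp only [sub_sub_cancel, scaled_apply, smul_mul_assoc, smul_smul, mul_inv_cancel₀ hε.ne', one_smul]

/-- Multiplication with a coordinate function. -/
def coordMul (i : Fin d) (η : 𝓢(Euc d, 𝕜)) : 𝓢(Euc d, 𝕜) :=
  SchwartzMap.smulLeftCLM 𝕜 (fun z : Euc d => z i) η

theorem coordMul_apply (i : Fin d) (η : 𝓢(Euc d, 𝕜)) (z : Euc d) :
    coordMul i η z = ((z i : ℝ) : 𝕜) * η z := by
  have h : Function.HasTemperateGrowth fun z : Euc d => z i :=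
    (EuclideanSpace.proj i : Euc d →L[ℝ] ℝ).hasTemperateGrowth
  rw [coordMul, SchwartzMap.smulLeftCLM_apply_apply h, RCLike.real_smul_eq_coe_mul]

/-- Rests on `1 + ‖x - t z‖ ≤ (1 + ‖x‖) R (1 + ‖z‖)`; the bound is uniform for `|t| ≤ R`, as
domination requires. -/
theorem norm_comp_sub_smul_le {u : Euc d → 𝕜} {C : ℝ} {K : ℕ} (hC : 0 ≤ C)
    (hu : ∀ x, ‖u x‖ ≤ C * (1 + ‖x‖) ^ K) {R t : ℝ} (hR : 1 ≤ R) (ht : |t| ≤ R) (x z : Euc d) :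
    ‖u (x - t • z)‖ ≤ C * (1 + ‖x‖) ^ K * R ^ K * (1 + ‖z‖) ^ K := by
  refine (hu _).trans ?_
  rw [mul_assoc, mul_assoc, ← mul_pow, ← mul_pow]
  gcongr
  have h1 : ‖x - t • z‖ ≤ ‖x‖ + |t| * ‖z‖ := by
    simpa [norm_smul] using norm_sub_le x (t • z)
  have h2 : |t| * ‖z‖ ≤ R * ‖z‖ := by gcongr
  have h3 : 0 ≤ ‖x‖ * R * ‖z‖ := by positivity
  have h4 : 0 ≤ ‖x‖ * (R - 1) := mul_nonneg (norm_nonneg _) (by linarith)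
  nlinarith

theorem integrable_dilAvg (η : 𝓢(Euc d, 𝕜)) (u : OM 𝕜 d) (x : Euc d) (t : ℝ) :
    Integrable fun z => η z * (u : Euc d → 𝕜) (x - t • z) := by
  obtain ⟨C, K, hC, hu⟩ := OM.exists_norm_le u
  refine Integrable.mono' ((η.integrable_one_add_norm_pow_mul K).const_mul
    (C * (1 + ‖x‖) ^ K * (|t| + 1) ^ K)) ?_ (Eventually.of_forall fun z => ?_)
  · have := (OM.differentiable u).continuous
    exact (η.continuous.mul (by fun_prop)).aestronglyMeasurable
  · rw [norm_mul]
    have := norm_comp_sub_smul_le hC hu (R := |t| + 1) (t := t) (by linarith [abs_nonneg t])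
      (by linarith) x z
    calc _ ≤ ‖η z‖ * (C * (1 + ‖x‖) ^ K * (|t| + 1) ^ K * (1 + ‖z‖) ^ K) := by gcongr
      _ = _ := by ring

theorem exists_norm_dilAvg_le (η : 𝓢(Euc d, 𝕜)) (u : OM 𝕜 d) :
    ∃ (C : ℝ) (K : ℕ), 0 ≤ C ∧ ∀ x, ∀ t ∈ Set.Icc (0 : ℝ) 1,
      ‖dilAvg η u x t‖ ≤ C * (1 + ‖x‖) ^ K := by
  obtain ⟨C, K, hC, hu⟩ := OM.exists_norm_le u
  refine ⟨C * ∫ z, (1 + ‖z‖) ^ K * ‖η z‖, K,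
    mul_nonneg hC (integral_nonneg fun z => by positivity), fun x t ht => ?_⟩
  have h1 : ‖dilAvg η u x t‖ ≤ ∫ z, C * (1 + ‖x‖) ^ K * ((1 + ‖z‖) ^ K * ‖η z‖) := by
    refine norm_integral_le_of_norm_le ((η.integrable_one_add_norm_pow_mul K).const_mul _)
      (Eventually.of_forall fun z => ?_)
    rw [norm_mul]
    have := norm_comp_sub_smul_le hC hu (R := 1) (t := t) le_rfl
      (by rw [abs_of_nonneg ht.1]; exact ht.2) x z
    calc _ ≤ ‖η z‖ * (C * (1 + ‖x‖) ^ K * 1 ^ K * (1 + ‖z‖) ^ K) := by gcongr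
      _ = _ := by ring
  refine h1.trans (le_of_eq ?_)
  rw [integral_const_mul]
  ring

theorem fderiv_eq_sum_pd (u : OM 𝕜 d) (x v : Euc d) :
    fderiv ℝ (u : Euc d → 𝕜) x v = ∑ i, ((v i : ℝ) : 𝕜) * (OM.pd 𝕜 i u : Euc d → 𝕜) x := by
  have hv : v = ∑ i : Fin d, v i • (stdVec i : Euc d) := by
    have := (EuclideanSpace.basisFun (Fin d) ℝ).sum_repr v
    simpa using this.symm
  conv_lhs => rw [hv]
  rw [map_sum]
  refine Finset.sum_congr rfl fun i _ => ?_
  rw [map_smul, RCLike.real_smul_eq_coe_mul, OM.pd_apply]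

/-- The chain rule produces factors `z_i`, which are absorbed into the kernel. The derivative is
thus again a sum of averages of the same type, so the argument can be iterated. -/
theorem hasDerivAt_dilAvg (η : 𝓢(Euc d, 𝕜)) (u : OM 𝕜 d) (x : Euc d) (t : ℝ) :
    HasDerivAt (dilAvg η u x) (-∑ i, dilAvg (coordMul i η) (OM.pd 𝕜 i u) x t) t := by
  have hd : ∀ z s, HasDerivAt (fun s : ℝ => η z * (u : Euc d → 𝕜) (x - s • z))
      (-∑ i, coordMul i η z * (OM.pd 𝕜 i u : Euc d → 𝕜) (x - s • z)) s := by
    intro z s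
    have h1 : HasDerivAt (fun s : ℝ => x - s • z) (-z) s := by
      simpa using ((hasDerivAt_id s).smul_const z).const_sub x
    have h2 := ((OM.differentiable u (x - s • z)).hasFDerivAt.comp_hasDerivAt s h1).const_mul (η z)
    refine h2.congr_deriv ?_
    rw [map_neg, fderiv_eq_sum_pd, mul_neg, Finset.mul_sum]
    congr 1
    refine Finset.sum_congr rfl fun i _ => ?_
    rw [coordMul_apply]
    ring
  choose C K hC hu using fun i : Fin d => OM.exists_norm_le (OM.pd 𝕜 i u)
  have hint : ∀ s i, Integrable fun z =>
      coordMul i η z * (OM.pd 𝕜 i u : Euc d → 𝕜) (x - s • z) := fun s i =>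
    integrable_dilAvg (coordMul i η) (OM.pd 𝕜 i u) x s
  have h3 := (hasDerivAt_integral_of_dominated_loc_of_deriv_le (𝕜 := ℝ) (μ := volume)
    (F := fun s z => η z * (u : Euc d → 𝕜) (x - s • z)) (x₀ := t) (s := Metric.ball t 1)
    (F' := fun s z => -∑ i, coordMul i η z * (OM.pd 𝕜 i u : Euc d → 𝕜) (x - s • z))
    (bound := fun z => ∑ i, C i * (1 + ‖x‖) ^ K i * (|t| + 1) ^ K i *
      ((1 + ‖z‖) ^ K i * ‖coordMul i η z‖))
    (Metric.ball_mem_nhds t one_pos)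
    (Eventually.of_forall fun s => (integrable_dilAvg η u x s).1)
    (integrable_dilAvg η u x t)
    (integrable_finsetSum _ fun i _ => hint t i).neg.1
    (Eventually.of_forall fun z s hs => ?_)
    (integrable_finsetSum _ fun i _ =>
      ((coordMul i η).integrable_one_add_norm_pow_mul (K i)).const_mul _)
    (Eventually.of_forall fun z s _ => hd z s)).2
  · refine h3.congr_deriv ?_
    rw [integral_neg, integral_finsetSum _ fun i _ => hint t i]
    rfl
  · rw [norm_neg]
    refine norm_sum_le_of_le _ fun i _ => ?_
    rw [norm_mul]
    have hs' : |s| ≤ |t| + 1 := by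
      rw [Metric.mem_ball, Real.dist_eq] at hs
      have := abs_sub_abs_le_abs_sub s t
      linarith
    have := norm_comp_sub_smul_le (hC i) (hu i) (R := |t| + 1) (t := s)
      (by linarith [abs_nonneg t]) hs' x z
    calc _ ≤ ‖coordMul i η z‖ *
          (C i * (1 + ‖x‖) ^ K i * (|t| + 1) ^ K i * (1 + ‖z‖) ^ K i) := by gcongr
      _ = _ := by ring

/-- All moments of `η`, including the integral, vanish. -/
def MomentsVanish (η : 𝓢(Euc d, 𝕜)) : Prop :=
  ∀ α : Fin d → ℕ, ∫ x, ((∏ i, x i ^ α i : ℝ) : 𝕜) * η x = 0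

/-- The factor `z_j` raises the multi-index by one, so even the zeroth moment of the new kernel is a
moment of `η` of positive order. -/
theorem momentsVanish_coordMul (η : 𝓢(Euc d, 𝕜))
    (h : ∀ α : Fin d → ℕ, α ≠ 0 → ∫ x, ((∏ i, x i ^ α i : ℝ) : 𝕜) * η x = 0) (j : Fin d) :
    MomentsVanish (coordMul j η) := by
  intro α
  have hne : α + Pi.single j 1 ≠ 0 := fun h0 => by
    have := congr_fun h0 j
    simp at this
  rw [← h (α + Pi.single j 1) hne]
  refine integral_congr_ae (Eventually.of_forall fun x => ?_)
  have hp : ∏ i, x i ^ (α + Pi.single j 1 : Fin d → ℕ) i = (∏ i, x i ^ α i) * x j := by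
    simp only [Pi.add_apply, pow_add, Finset.prod_mul_distrib]
    congr 1
    rw [Finset.prod_eq_single j]
    · simp
    · intro i _ hi
      simp [hi]
    · simp
  simp only [hp, coordMul_apply]
  push_cast
  ring

theorem MomentsVanish.dilAvg_zero {η : 𝓢(Euc d, 𝕜)} (h : MomentsVanish η) (u : OM 𝕜 d)
    (x : Euc d) : dilAvg η u x 0 = 0 := by
  have h0 := h 0
  simp only [Pi.zero_apply, pow_zero, Finset.prod_const_one, RCLike.ofReal_one, one_mul] at h0
  simp [dilAvg, integral_mul_const, h0]

/-- Each use of the mean value inequality gains one power of `t`: the averages in the derivative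
vanish at `t = 0`, so the inductive hypothesis bounds their values themselves. The hypothesis
concerns `z_i η` and not `η`, so that it applies to `ρ`, whose integral is 1. -/
theorem exists_norm_dilAvg_sub_le (m : ℕ) : ∀ (η : 𝓢(Euc d, 𝕜)) (u : OM 𝕜 d),
    (∀ i, MomentsVanish (coordMul i η)) →
    ∃ (C : ℝ) (K : ℕ), 0 ≤ C ∧ ∀ x, ∀ t ∈ Set.Icc (0 : ℝ) 1,
      ‖dilAvg η u x t - dilAvg η u x 0‖ ≤ C * t ^ m * (1 + ‖x‖) ^ K := by
  induction m with
  | zero =>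
    intro η u _
    obtain ⟨C, K, hC, h⟩ := exists_norm_dilAvg_le η u
    refine ⟨C + C, K, by positivity, fun x t ht => ?_⟩
    refine (norm_sub_le_of_le (h x t ht) (h x 0 (by simp))).trans (le_of_eq (by ring))
  | succ m ih =>
    intro η u hη
    choose C K hC h using fun i => ih (coordMul i η) (OM.pd 𝕜 i u) fun j =>
      momentsVanish_coordMul _ (fun α _ => hη i α) j
    refine ⟨∑ i, C i, ∑ i, K i, Finset.sum_nonneg fun i _ => hC i, fun x t ht => ?_⟩
    have hb : ∀ s ∈ Set.Icc 0 t, ‖-∑ i, dilAvg (coordMul i η) (OM.pd 𝕜 i u) x s‖ ≤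
        (∑ i, C i) * t ^ m * (1 + ‖x‖) ^ (∑ i, K i) := by
      intro s hs
      rw [norm_neg, mul_assoc, Finset.sum_mul]
      refine norm_sum_le_of_le _ fun i _ => ?_
      have h1 := h i x s ⟨hs.1, hs.2.trans ht.2⟩
      -- Vanishing of the integral of `z_i η` removes the subtracted value at 0.
      rw [(hη i).dilAvg_zero, sub_zero, mul_assoc] at h1
      refine h1.trans (mul_le_mul_of_nonneg_left ?_ (hC i))
      have h2 : K i ≤ ∑ i, K i :=
        Finset.single_le_sum (f := K) (fun _ _ => Nat.zero_le _) (Finset.mem_univ i)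
      have h3 : (1 + ‖x‖) ^ K i ≤ (1 + ‖x‖) ^ (∑ i, K i) :=
        pow_le_pow_right₀ (by linarith [norm_nonneg x]) h2
      have h4 : s ^ m ≤ t ^ m := pow_le_pow_left₀ hs.1 hs.2 m
      exact mul_le_mul h4 h3 (by positivity) (pow_nonneg ht.1 _)
    have := Convex.norm_image_sub_le_of_norm_hasDerivWithin_le
      (fun s _ => (hasDerivAt_dilAvg η u x s).hasDerivWithinAt) hb (convex_Icc 0 t)
      (Set.left_mem_Icc.2 ht.1) (Set.right_mem_Icc.2 ht.1)
    refine this.trans (le_of_eq ?_)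
    rw [sub_zero, Real.norm_of_nonneg ht.1]
    ring

/-- For a mollifier with vanishing moments, `(T_u * ρ_ε - u)_ε` is negligible. -/
theorem nu_convOM_toTDist_sub_isLittleO (ρ : 𝓢(Euc d, 𝕜)) (hρ : ∫ x, ρ x = 1)
    (hρ' : ∀ α : Fin d → ℕ, α ≠ 0 → ∫ x, ((∏ i, x i ^ α i : ℝ) : 𝕜) * ρ x = 0)
    (u : OM 𝕜 d) (φ : 𝓢(Euc d, 𝕜)) (l m : ℕ) :
    (fun ε : Par => nu φ l ((OM.toTDist u).convOM (scaled ρ ε) - u)) =o[toZero]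
      fun ε : Par => (ε : ℝ) ^ m := by
  obtain ⟨B, hB⟩ := exists_nu_le (f := fun ε : Par => (OM.toTDist u).convOM (scaled ρ ε) - u)
    (r := fun ε : Par => (ε : ℝ) ^ (m + 1)) (fun ε => pow_nonneg ε.2.1.le _) φ l (by
      intro α _
      -- The order `m + 1` leaves one power of `ε` to spare for the little-o.
      obtain ⟨C, K, hC, h⟩ := exists_norm_dilAvg_sub_le (m + 1) ρ (OM.deriv α u)
        (momentsVanish_coordMul ρ hρ')
      refine ⟨C, K, hC, fun ε x => ?_⟩
      have h1 := h x ε ⟨ε.2.1.le, ε.2.2⟩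
      have h0 : dilAvg ρ (OM.deriv α u) x 0 = (OM.deriv α u : Euc d → 𝕜) x := by
        simp [dilAvg, integral_mul_const, hρ]
      rw [← conv_scaled_toTDist, ← OM.deriv_toTDist, h0] at h1
      rw [map_sub, TDist.deriv_convOM]
      exact h1)
  have := isLittleO_zpow_of_le (k := (m : ℤ)) (C := B) (fun ε => nu_nonneg _ _ _) fun ε => by
    have h2 : ((m : ℤ) + 1) = ((m + 1 : ℕ) : ℤ) := by push_cast; ring
    rw [h2, zpow_natCast]
    exact hB ε
  exact this.congr_right fun ε => zpow_natCast _ _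

/-! ### The embeddings -/

theorem GTau.mk_eq_zero_iff (f : Moderate 𝕜 d) : GTau.mk 𝕜 d f = 0 ↔
    ∀ (φ : 𝓢(Euc d, 𝕜)) (l m : ℕ),
      (fun ε => nu φ l (f.1 ε)) =o[toZero] fun ε : Par => (ε : ℝ) ^ m :=
  GTau.mk_eq_zero f

/-- The case `l = m = 0` of negligibility, already enough for both injectivity statements. -/
theorem GTau.tendsto_nu_of_mk_eq_zero {f : Moderate 𝕜 d} (hf : GTau.mk 𝕜 d f = 0)
    (φ : 𝓢(Euc d, 𝕜)) : Tendsto (fun ε => nu φ 0 (f.1 ε)) toZero (𝓝 0) := by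
  have := (GTau.mk_eq_zero_iff f).1 hf φ 0 0
  simpa [isLittleO_one_iff] using this

theorem sigmaTau_injective : Function.Injective (sigmaTau 𝕜 d) := by
  refine (injective_iff_map_eq_zero _).2 fun u hu => OM.eq_zero_of_nu_eq_zero u fun φ => ?_
  rw [sigmaTau_apply] at hu
  -- The family is constant in `ε`, so its seminorm is a constant tending to 0.
  exact tendsto_nhds_unique tendsto_const_nhds (GTau.tendsto_nu_of_mk_eq_zero hu φ)

theorem sigmaTau_pd (i : Fin d) (u : OM 𝕜 d) :
    sigmaTau 𝕜 d (OM.pd 𝕜 i u) = GTau.pd 𝕜 i (sigmaTau 𝕜 d u) := by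
  rw [sigmaTau_apply, sigmaTau_apply, GTau.pd_mk]
  rfl

/-- The map `ι_τ : S'(ℝ^d) → G_τ(ℝ^d)`, `T ↦ (T * ρ_ε)_ε + N_{O_M}(ℝ^d)`. -/
def iotaTau (ρ : 𝓢(Euc d, 𝕜)) : TDist 𝕜 d →ₗ[𝕜] GTau 𝕜 d :=
  (GTau.mk 𝕜 d).toLinearMap ∘ₗ
    { toFun := fun T => ⟨fun ε => T.convOM (scaled ρ ε), T.conv_scaled_mem_moderate ρ⟩
      map_add' := fun _ _ => rfl
      map_smul' := fun _ _ => rfl }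

theorem iotaTau_apply (ρ : 𝓢(Euc d, 𝕜)) (T : TDist 𝕜 d) : iotaTau ρ T =
    GTau.mk 𝕜 d ⟨fun ε => T.convOM (scaled ρ ε), T.conv_scaled_mem_moderate ρ⟩ := rfl

theorem iotaTau_injective (ρ : 𝓢(Euc d, 𝕜)) (hρ : ∫ x, ρ x = 1) :
    Function.Injective (iotaTau ρ) := by
  refine (injective_iff_map_eq_zero _).2 fun T hT => T.eq_zero_of_negligible ρ hρ fun φ => ?_
  rw [iotaTau_apply] at hT
  exact GTau.tendsto_nu_of_mk_eq_zero hT φ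

theorem iotaTau_pd (ρ : 𝓢(Euc d, 𝕜)) (i : Fin d) (T : TDist 𝕜 d) :
    iotaTau ρ (TDist.pd 𝕜 i T) = GTau.pd 𝕜 i (iotaTau ρ T) := by
  rw [iotaTau_apply, iotaTau_apply, GTau.pd_mk]
  congr 1
  exact Subtype.ext (funext fun ε => (T.pd_convOM _ i).symm)

theorem iotaTau_toTDist (ρ : 𝓢(Euc d, 𝕜)) (hρ : ∫ x, ρ x = 1)
    (hρ' : ∀ α : Fin d → ℕ, α ≠ 0 → ∫ x, ((∏ i, x i ^ α i : ℝ) : 𝕜) * ρ x = 0) (u : OM 𝕜 d) :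
    iotaTau ρ (OM.toTDist u) = sigmaTau 𝕜 d u := by
  rw [← sub_eq_zero, iotaTau_apply, sigmaTau_apply, ← map_sub, GTau.mk_eq_zero_iff]
  exact fun φ l m => nu_convOM_toTDist_sub_isLittleO ρ hρ hρ' u φ l m

end TemperedGF

end

theorem mainTheorem3 {𝕜 : Type*} [RCLike 𝕜] (d : ℕ) (ρ : 𝓢(Euc d, 𝕜))
    (hρ_one : ∫ x, ρ x = 1)
    (hρ_moments : ∀ α : Fin d → ℕ, α ≠ 0 → ∫ x, ((∏ i, x i ^ α i : ℝ) : 𝕜) * ρ x = 0) :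
    -- (i) `σ_τ` is an embedding of differential algebras
    (Function.Injective (sigmaTau 𝕜 d) ∧
      ∀ (α : Fin d → ℕ) (u : OM 𝕜 d),
        sigmaTau 𝕜 d (OM.deriv α u) = GTau.deriv α (sigmaTau 𝕜 d u)) ∧
    -- `ι_τ` is well defined: `(T * ρ_ε)_ε` is a moderate family of functions in `O_M`
    ∃ (hOM : ∀ (T : TDist 𝕜 d) (ε : Par), T.conv (scaled ρ ε) ∈ OM 𝕜 d)
      (hMod : ∀ T : TDist 𝕜 d,
        (fun ε : Par => (⟨T.conv (scaled ρ ε), hOM T ε⟩ : OM 𝕜 d)) ∈ Moderate 𝕜 d)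
      (ι : TDist 𝕜 d →ₗ[𝕜] GTau 𝕜 d),
      (∀ T : TDist 𝕜 d, ι T =
        GTau.mk 𝕜 d ⟨fun ε : Par => (⟨T.conv (scaled ρ ε), hOM T ε⟩ : OM 𝕜 d), hMod T⟩) ∧
      -- (ii) `ι_τ` is an embedding of differential vector spaces
      (Function.Injective ι ∧
        ∀ (α : Fin d → ℕ) (T : TDist 𝕜 d), ι (TDist.deriv α T) = GTau.deriv α (ι T)) ∧
      -- (iii) `ι_τ` restricted to `O_M` is `σ_τ`
      ∀ u : OM 𝕜 d, ι (OM.toTDist u) = sigmaTau 𝕜 d u := by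
  refine ⟨⟨?_, fun α u => ?_⟩, fun T ε => T.conv_mem_OM _, fun T => T.conv_scaled_mem_moderate ρ,
    iotaTau ρ, fun T => rfl, ⟨?_, fun α T => ?_⟩, fun u => ?_⟩
  · exact sigmaTau_injective
  · exact multiDeriv_intertwine (fun u => sigmaTau 𝕜 d u)
      (fun i => (OM.pd 𝕜 i : OM 𝕜 d →ₗ[𝕜] OM 𝕜 d)) _ (fun i u => (sigmaTau_pd i u)) α u
  · exact iotaTau_injective ρ hρ_one
  · exact multiDeriv_intertwine (fun T => iotaTau ρ T) (TDist.pd 𝕜) _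
      (fun i T => iotaTau_pd ρ i T) α T
  · exact iotaTau_toTDist ρ hρ_one hρ_moments u
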